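/- Let $G$ be a compact Lie group with semisimple Lie algebra $\mathfrak g$ and Killing form $B$, let $K\subset G$ be a closed subgroup with Lie algebra $\mathfrak k$, and let $\mathfrak g=\mathfrak k\oplus\mathfrak p$ be the $B$-orthogonal decomposition, so that $T_o(G/K)\equiv\mathfrak p$ and the $G$-invariant metrics on $G/K$ are the $\mathrm{Ad}(K)$-invariant inner products on $\mathfrak p$. Let $g_B$ be the standard metric on $G/K$, i.e. the one given by $-B|_{\mathfrak p\times\mathfrak p}$, and let $\mathcal M_1^G$ be the space of all $G$-invariant Riemannian metrics on $G/K$ with the same volume as $g_B$. Suppose that $\mathfrak p=\mathfrak p_1\oplus\mathfrak p_2$ is an orthogonal decomposition into two $\mathrm{Ad}(K)$-irreducible, inequivalent subspaces. Put $d_i=\dim\mathfrak p_i$ and $[ijk]=\sum_{\alpha,\beta,\gamma}\big(-B([X^i_\alpha,X^j_\beta],X^k_\gamma)\big)^2$, where $\{X^i_\alpha\}_\alpha$ is a $(-B)$-orthonormal basis of $\mathfrak p_i$. Assume that $d_1=d_2$, $[111]=[222]$, $[112]=[122]>0$, and that $g_B$ is Einstein. Then the following conditions are equivalent: (i) $g_B$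 is a global maximum of the scalar curvature $\mathrm{Sc}$ on $\mathcal M_1^G$; (ii) $g_B$ is the unique Einstein metric in $\mathcal M_1^G$ (i.e. the unique $G$-invariant Einstein metric on $G/K$ up to scaling). Otherwise, $g_B$ is a local minimum of $\mathrm{Sc}|_{\mathcal M_1^G}$ and there are exactly two other Einstein metrics in $\mathcal M_1^G$; both of them are local maxima of $\mathrm{Sc}|_{\mathcal M_1^G}$, and at least one of them is a global maximum. -/

import Mathlib

open scoped Manifold ContDiff Topology

noncomputable section

/-! ### Curvature of invariant metrics: the linear algebra

`L` is a real Lie algebra with a vector space decomposition `L = 𝔭 ⊕ 𝔨`, and `g` is a nondegenerate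
symmetric bilinear form on `𝔭`.  If `L` and `𝔨` are the Lie algebras of `G` and `K` and the
decomposition is reductive, then `𝔭` is the tangent space of `G/K` at the base point `o`, `g` is the
value at `o` of a `G`-invariant metric, and the formulas below are the Levi-Civita connection
(in Nomizu's description of invariant connections) and its curvature at `o`. -/

namespace HomogeneousGeometry

section LinearAlgebra

variable {L : Type*} [LieRing L] [LieAlgebra ℝ L] [Module.Finite ℝ L] {𝔨 𝔭 : Submodule ℝ L}

/-- `adProj h Z X = [Z, X]_𝔭`, the `𝔭`-component of the bracket, for `Z ∈ L` and `X ∈ 𝔭`. -/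
def adProj (h : IsCompl 𝔭 𝔨) : L →ₗ[ℝ] 𝔭 →ₗ[ℝ] 𝔭 :=
  LinearMap.mk₂ ℝ (fun Z X => 𝔭.projectionOnto 𝔨 h ⁅Z, (X : L)⁆)
    (by intros; simp) (by intros; simp) (by intros; simp) (by intros; simp)

/-- `[X, Y]_𝔨`, the `𝔨`-component of the bracket of `X, Y ∈ 𝔭`, as an element of `L`. -/
def bracketK (h : IsCompl 𝔭 𝔨) : 𝔭 →ₗ[ℝ] 𝔭 →ₗ[ℝ] L :=
  LinearMap.mk₂ ℝ (fun X Y => (𝔨.projectionOnto 𝔭 h.symm ⁅(X : L), (Y : L)⁆ : L))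
    (by intros; simp) (by intros; simp) (by intros; simp) (by intros; simp)

/-- The right-hand side of the Koszul formula: the linear functional
`Z ↦ ½ (g([X,Y]_𝔭, Z) - g([X,Z]_𝔭, Y) - g(X, [Y,Z]_𝔭))` on `𝔭`. -/
def koszul (h : IsCompl 𝔭 𝔨) (g : LinearMap.BilinForm ℝ 𝔭) (X Y : 𝔭) : Module.Dual ℝ 𝔭 :=
  (1 / 2 : ℝ) • (g (adProj h X Y) - g.flip Y ∘ₗ adProj h X - g X ∘ₗ adProj h Y)

/-- The Levi-Civita connection of the invariant metric `g`, as the bilinear map `Λ : 𝔭 × 𝔭 → 𝔭` with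
`g(Λ(X)Y, Z) = ½ (g([X,Y]_𝔭, Z) + g([Z,X]_𝔭, Y) + g(X, [Z,Y]_𝔭))`.  It is the only one for which
every `Λ(X)` is `g`-skew (metric) and `Λ(X)Y - Λ(Y)X = [X,Y]_𝔭` (torsion free). -/
def leviCivita (h : IsCompl 𝔭 𝔨) (g : LinearMap.BilinForm ℝ 𝔭) (hg : g.Nondegenerate) :
    𝔭 →ₗ[ℝ] 𝔭 →ₗ[ℝ] 𝔭 :=
  LinearMap.mk₂ ℝ (fun X Y => (g.toDual hg).symm (koszul h g X Y))
    (by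
      intro X X' Y
      rw [← map_add]; congr 1; ext Z
      simp [koszul]; ring)
    (by
      intro c X Y
      rw [← map_smul]; congr 1; ext Z
      simp [koszul]; ring)
    (by
      intro X Y Y'
      rw [← map_add]; congr 1; ext Z
      simp [koszul]; ring)
    (by
      intro c X Y
      rw [← map_smul]; congr 1; ext Z
      simp [koszul]; ring)

theorem leviCivita_spec (h : IsCompl 𝔭 𝔨) (g : LinearMap.BilinForm ℝ 𝔭) (hg : g.Nondegenerate)
    (X Y Z : 𝔭) : g (leviCivita h g hg X Y) Z =
      1 / 2 * (g (adProj h X Y) Z - g (adProj h X Z) Y - g X (adProj h Y Z)) := by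
  simp [leviCivita, koszul]

/-- The curvature tensor
`R(X,Y)Z = Λ(X)Λ(Y)Z - Λ(Y)Λ(X)Z - Λ([X,Y]_𝔭)Z - [[X,Y]_𝔨, Z]`. -/
def curvature (h : IsCompl 𝔭 𝔨) (g : LinearMap.BilinForm ℝ 𝔭) (hg : g.Nondegenerate)
    (X Y Z : 𝔭) : 𝔭 :=
  leviCivita h g hg X (leviCivita h g hg Y Z) - leviCivita h g hg Y (leviCivita h g hg X Z)
    - leviCivita h g hg (adProj h X Y) Z - adProj h (bracketK h X Y) Z

/-- The linear map `X ↦ R(X,Y)Z`. -/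
def curvatureMap (h : IsCompl 𝔭 𝔨) (g : LinearMap.BilinForm ℝ 𝔭) (hg : g.Nondegenerate)
    (Y Z : 𝔭) : 𝔭 →ₗ[ℝ] 𝔭 where
  toFun X := curvature h g hg X Y Z
  map_add' X X' := by simp [curvature]; abel
  map_smul' c X := by simp [curvature, smul_sub]

/-- The Ricci tensor `Ric(Y,Z) = tr (X ↦ R(X,Y)Z)`. -/
def ricci (h : IsCompl 𝔭 𝔨) (g : LinearMap.BilinForm ℝ 𝔭) (hg : g.Nondegenerate) :
    LinearMap.BilinForm ℝ 𝔭 :=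
  LinearMap.mk₂ ℝ (fun Y Z => LinearMap.trace ℝ 𝔭 (curvatureMap h g hg Y Z))
    (by
      intro Y Y' Z
      rw [← map_add]; congr 1; ext1 X
      simp [curvatureMap, curvature]; abel)
    (by
      intro c Y Z
      rw [← map_smul]; congr 1; ext1 X
      simp [curvatureMap, curvature, smul_sub])
    (by
      intro Y Z Z'
      rw [← map_add]; congr 1; ext1 X
      simp [curvatureMap, curvature]; abel)
    (by
      intro c Y Z
      rw [← map_smul]; congr 1; ext1 X
      simp [curvatureMap, curvature, smul_sub])

/-- The scalar curvature: the trace of the Ricci operator, i.e. of the endomorphism `A` of `𝔭` with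
`g(A X, Y) = Ric(X, Y)`. -/
def scalarCurvature (h : IsCompl 𝔭 𝔨) (g : LinearMap.BilinForm ℝ 𝔭) (hg : g.Nondegenerate) : ℝ :=
  LinearMap.trace ℝ 𝔭 ((g.toDual hg).symm.toLinearMap ∘ₗ ricci h g hg)

/-- The number `∑_{α,β,γ} ⟨[e₁ α, e₂ β], e₃ γ⟩²`, where `⟨·,·⟩ = -B` and `B` is the Killing form.
If `e₁, e₂, e₃` are orthonormal bases of subspaces `𝔭ᵢ, 𝔭ⱼ, 𝔭ₖ`, this is the structural
constant `[ijk]`. -/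
def structuralConstant {ι₁ ι₂ ι₃ : Type*} [Fintype ι₁] [Fintype ι₂] [Fintype ι₃]
    (e₁ : ι₁ → L) (e₂ : ι₂ → L) (e₃ : ι₃ → L) : ℝ :=
  ∑ α, ∑ β, ∑ γ, (-killingForm ℝ L ⁅e₁ α, e₂ β⁆ (e₃ γ)) ^ 2

end LinearAlgebra

/-! ### Homogeneous spaces -/

section LieGroup

variable {E : Type*} [NormedAddCommGroup E] [NormedSpace ℝ E]
  {G : Type*} [TopologicalSpace G] [ChartedSpace E G] [Group G]

instance lieGroup_minSmoothness [LieGroup 𝓘(ℝ, E) ∞ G] :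
    LieGroup 𝓘(ℝ, E) (minSmoothness ℝ 3) G := by
  rw [minSmoothness_of_isRCLikeNormedField]
  infer_instance

instance finite_groupLieAlgebra [FiniteDimensional ℝ E] :
    Module.Finite ℝ (GroupLieAlgebra 𝓘(ℝ, E) G) :=
  inferInstanceAs (Module.Finite ℝ E)

/-- The adjoint representation: `Ad k` is the derivative at the identity of the conjugation
`x ↦ k x k⁻¹`.  (All tangent spaces of `G` are copies of `E`, and `k 1 k⁻¹ = 1`.) -/
def Ad (k : G) : GroupLieAlgebra 𝓘(ℝ, E) G →ₗ[ℝ] GroupLieAlgebra 𝓘(ℝ, E) G :=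
  (mfderiv 𝓘(ℝ, E) 𝓘(ℝ, E) (fun x : G => k * x * k⁻¹) 1 : E →L[ℝ] E).toLinearMap

/-- The velocity at time `0` of a curve `γ` in `G` with `γ 0 = 1`. -/
def velocity (γ : ℝ → G) : GroupLieAlgebra 𝓘(ℝ, E) G :=
  (mfderiv 𝓘(ℝ, ℝ) 𝓘(ℝ, E) γ 0 : ℝ →L[ℝ] E) 1

variable (E) in
/-- The Lie algebra of a closed subgroup `K` of `G`: the velocities at `1` of the smooth curves of `G`
that run in `K`.  (These velocities already form a subspace; the span makes it one by definition.) -/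
def lieAlgebraOf (K : Subgroup G) : Submodule ℝ (GroupLieAlgebra 𝓘(ℝ, E) G) :=
  Submodule.span ℝ {X | ∃ γ : ℝ → G, ContMDiff 𝓘(ℝ, ℝ) 𝓘(ℝ, E) ∞ γ ∧ γ 0 = 1 ∧
    (∀ t, γ t ∈ K) ∧ velocity γ = X}

variable (E) in
/-- A reductive decomposition `𝔤 = 𝔨 ⊕ 𝔭` for `G/K`; `𝔭` is then identified with `T_o(G/K)`,
and the isotropy representation of `K` on it is `Ad`. -/
structure ReductiveDecomposition (K : Subgroup G) where
  /-- the complement -/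
  𝔭 : Submodule ℝ (GroupLieAlgebra 𝓘(ℝ, E) G)
  isCompl : IsCompl 𝔭 (lieAlgebraOf E K)
  Ad_mem : ∀ k ∈ K, ∀ X ∈ 𝔭, Ad k X ∈ 𝔭

/-- A `G`-invariant Riemannian metric on `G/K`, given by its value at the base point: an
`Ad(K)`-invariant inner product on `𝔭`. -/
@[ext]
structure InvariantMetric {K : Subgroup G} (D : ReductiveDecomposition E K) where
  /-- the inner product on `𝔭` -/
  form : LinearMap.BilinForm ℝ D.𝔭
  symm : ∀ X Y, form X Y = form Y X
  pos : ∀ X, X ≠ 0 → 0 < form X X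
  invariant : ∀ (k : G) (hk : k ∈ K) (X Y : D.𝔭),
    form ⟨Ad k X, D.Ad_mem k hk X X.2⟩ ⟨Ad k Y, D.Ad_mem k hk Y Y.2⟩ = form X Y

namespace InvariantMetric

variable {K : Subgroup G} {D : ReductiveDecomposition E K}

/-- The topology of the space of invariant metrics as a subset of the finite-dimensional space of
bilinear forms on `𝔭` (pointwise convergence). -/
instance : TopologicalSpace (InvariantMetric D) :=
  TopologicalSpace.induced (fun g (X Y : D.𝔭) => g.form X Y) inferInstance

theorem nondegenerate (g : InvariantMetric D) : g.form.Nondegenerate := by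
  refine ⟨fun X hX => ?_, fun X hX => ?_⟩ <;>
  · by_contra hne
    exact absurd (hX X) (g.pos X hne).ne'

variable [FiniteDimensional ℝ E] [LieGroup 𝓘(ℝ, E) ∞ G]

/-- The Ricci tensor of an invariant metric (at the base point). -/
def ric (g : InvariantMetric D) : LinearMap.BilinForm ℝ D.𝔭 :=
  ricci D.isCompl g.form g.nondegenerate

/-- The scalar curvature of an invariant metric (a constant function on `G/K`). -/
def scal (g : InvariantMetric D) : ℝ :=
  scalarCurvature D.isCompl g.form g.nondegenerate

/-- `g` is Einstein: `Ric(g) = ρ g` for some constant `ρ`. -/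
def IsEinstein (g : InvariantMetric D) : Prop :=
  ∃ ρ : ℝ, g.ric = ρ • g.form

/-- The Riemannian volume density at the base point, i.e. the volume of the parallelepiped spanned by
a fixed basis of `𝔭 = T_o(G/K)`.  The total volume of `G/K` is a constant multiple of it. -/
def volDensity (g : InvariantMetric D) : ℝ :=
  √(LinearMap.BilinForm.toMatrix (Module.finBasis ℝ D.𝔭) g.form).det

/-- The space `𝓜₁ᴳ` of all invariant metrics with the same volume as `g₀`. -/
def sameVolume (g₀ : InvariantMetric D) : Set (InvariantMetric D) :=
  {g | g.volDensity = g₀.volDensity}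

/-- `g` is the standard (Killing) metric: the decomposition `𝔤 = 𝔨 ⊕ 𝔭` is orthogonal with respect
to the Killing form `B` of `𝔤`, and `g = -B` on `𝔭`. -/
def IsStandard (g : InvariantMetric D) : Prop :=
  (∀ Z ∈ lieAlgebraOf E K, ∀ X ∈ D.𝔭, killingForm ℝ (GroupLieAlgebra 𝓘(ℝ, E) G) Z X = 0) ∧
  ∀ X Y : D.𝔭, g.form X Y = -killingForm ℝ (GroupLieAlgebra 𝓘(ℝ, E) G) X Y

/-- `g` is a global maximum of the scalar curvature on the metrics of its volume. -/
def IsGlobalMax (g : InvariantMetric D) : Prop := IsMaxOn scal g.sameVolume g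

/-- `g` is a local maximum of the scalar curvature on the metrics of its volume. -/
def IsLocalMaximum (g : InvariantMetric D) : Prop := IsLocalMaxOn scal g.sameVolume g

/-- `g` is a local minimum of the scalar curvature on the metrics of its volume. -/
def IsLocalMinimum (g : InvariantMetric D) : Prop := IsLocalMinOn scal g.sameVolume g

end InvariantMetric

/-- An `Ad(K)`-invariant subspace of `𝔤`. -/
def IsAdInvariant (K : Subgroup G) (V : Submodule ℝ (GroupLieAlgebra 𝓘(ℝ, E) G)) : Prop :=
  ∀ k ∈ K, ∀ X ∈ V, Ad k X ∈ V

/-- An `Ad(K)`-irreducible subspace of `𝔤`. -/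
def IsAdIrreducible (K : Subgroup G) (V : Submodule ℝ (GroupLieAlgebra 𝓘(ℝ, E) G)) : Prop :=
  IsAdInvariant K V ∧ V ≠ ⊥ ∧ ∀ W ≤ V, IsAdInvariant K W → W = ⊥ ∨ W = V

/-- Two `Ad(K)`-invariant subspaces of `𝔤` are equivalent as representations of `K`. -/
def AdEquivalent (K : Subgroup G) (V W : Submodule ℝ (GroupLieAlgebra 𝓘(ℝ, E) G)) : Prop :=
  ∃ φ : V ≃ₗ[ℝ] W, ∀ k ∈ K, ∀ X Y : V,
    Y.1 = Ad k X.1 → (φ Y).1 = Ad k (φ X).1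

variable [FiniteDimensional ℝ E] [LieGroup 𝓘(ℝ, E) ∞ G]

/-- `𝔭 = 𝔭₁ ⊕ ⋯ ⊕ 𝔭ᵣ` is a decomposition into pairwise orthogonal (for the Killing form),
`Ad(K)`-irreducible and pairwise inequivalent subspaces. -/
structure IsIsotropyDecomposition {K : Subgroup G} (D : ReductiveDecomposition E K) {r : ℕ}
    (V : Fin r → Submodule ℝ (GroupLieAlgebra 𝓘(ℝ, E) G)) : Prop where
  iSup_eq : ⨆ i, V i = D.𝔭
  orthogonal : ∀ i j, i ≠ j → ∀ X ∈ V i, ∀ Y ∈ V j,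
    killingForm ℝ (GroupLieAlgebra 𝓘(ℝ, E) G) X Y = 0
  irreducible : ∀ i, IsAdIrreducible K (V i)
  inequivalent : ∀ i j, i ≠ j → ¬ AdEquivalent K (V i) (V j)

/-- `e` is an orthonormal basis of `V` with respect to `-B`, where `B` is the Killing form. -/
def IsOrthonormalBasis {ι : Type*} [DecidableEq ι]
    (V : Submodule ℝ (GroupLieAlgebra 𝓘(ℝ, E) G)) (e : ι → GroupLieAlgebra 𝓘(ℝ, E) G) : Prop :=
  Submodule.span ℝ (Set.range e) = V ∧
  ∀ α β, -killingForm ℝ (GroupLieAlgebra 𝓘(ℝ, E) G) (e α) (e β) = if α = β then 1 else 0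

end LieGroup

end HomogeneousGeometry

end

/-! By Schur's lemma an invariant metric is `x₀(-B)` on `𝔭₁` plus `x₁(-B)` on `𝔭₂`, and since `d₁ =
d₂` equal volume means `x₀ x₁ = 1`. So `𝓜₁ᴳ` is the half-line `X = x₀ > 0`, with `g_B` at `X = 1`.

In a Killing-orthonormal basis the Ricci tensor is a weighted sum of products of structure
constants, minus a term from the `𝔨`-bracket that does not involve the metric (`ricci_basis`). The
Einstein equation of `g_B`, with constant `ρ`, eliminates that term (`HasCoefficients.ric_basis`).
Schur's lemma applied to `bracketForm` turns the remaining sums into the `[ijk]`. With `b = [112]`,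
`A = d₁ρ + b/4` and `t = X + X⁻¹`, this gives `Sc = A t - (b/4)(t³ - 3t)`, because `X³ + X⁻³ = t³ -
3t`; the Einstein condition becomes `X = 1` or `A = (3b/4)(t² - 1)`.

The rest is calculus (`max_iff_unique_critical`). The cubic is strictly concave on `t ≥ 2`, the
range of `t`. If its slope at `t = 2` is nonpositive, i.e. `4A ≤ 9b`, then `g_B` is the maximum and
the only Einstein metric. Otherwise the cubic increases from `t = 2` to a maximum at some `T > 2`,
attained at two reciprocal values of `X`, and `g_B` is a local minimum. -/

namespace HomogeneousGeometry

/-! ### The adjoint action by Lie algebra automorphisms -/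

section Adjoint

variable {E : Type*} [NormedAddCommGroup E] [NormedSpace ℝ E]
  {G : Type*} [TopologicalSpace G] [ChartedSpace E G] [Group G]

variable (E) in
/-- The derivative at `x` of the conjugation by `k`, as an endomorphism of the model space. -/
noncomputable def dConj (k x : G) : E →L[ℝ] E :=
  mfderiv 𝓘(ℝ, E) 𝓘(ℝ, E) (fun y : G => k * y * k⁻¹) x

variable (E) in
/-- The derivative at `x` of the left translation by `k`, as an endomorphism of the model space. -/
noncomputable def dMul (k x : G) : E →L[ℝ] E :=
  mfderiv 𝓘(ℝ, E) 𝓘(ℝ, E) (fun y : G => k * y) x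

theorem dConj_one (x : G) : dConj E 1 x = ContinuousLinearMap.id ℝ E := by
  have h : (fun x : G => 1 * x * 1⁻¹) = id := by ext; simp
  unfold dConj
  rw [h, mfderiv_id]
  rfl

theorem Ad_one (X : GroupLieAlgebra 𝓘(ℝ, E) G) : Ad (1 : G) X = X :=
  congrArg (fun T : E →L[ℝ] E => T X) (dConj_one (1 : G))

variable [LieGroup 𝓘(ℝ, E) ∞ G]

theorem contMDiff_conj (k : G) : ContMDiff 𝓘(ℝ, E) 𝓘(ℝ, E) ∞ (fun x : G => k * x * k⁻¹) :=
  (contMDiff_mul_right (a := k⁻¹)).comp (contMDiff_mul_left (a := k))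

theorem mdifferentiableAt_conj (k x : G) :
    MDifferentiableAt 𝓘(ℝ, E) 𝓘(ℝ, E) (fun x : G => k * x * k⁻¹) x :=
  (contMDiff_conj k).mdifferentiableAt (by simp)

theorem mdifferentiableAt_mul_left (k x : G) :
    MDifferentiableAt 𝓘(ℝ, E) 𝓘(ℝ, E) (fun x : G => k * x) x :=
  (contMDiff_mul_left (I := 𝓘(ℝ, E)) (n := ∞) (a := k)).mdifferentiableAt (by simp)

theorem dConj_comp (k l x : G) : (dConj E k (l * x * l⁻¹)).comp (dConj E l x) =
    dConj E (k * l) x := by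
  have h := mfderiv_comp (I' := 𝓘(ℝ, E)) x (mdifferentiableAt_conj (E := E) k (l * x * l⁻¹))
    (mdifferentiableAt_conj (E := E) l x)
  have e : (fun y : G => k * y * k⁻¹) ∘ (fun y : G => l * y * l⁻¹) =
      fun y : G => (k * l) * y * (k * l)⁻¹ := by
    ext y; simp [mul_assoc]
  rw [e] at h
  exact h.symm

/-- Differentiates `k(xy)k⁻¹ = (kxk⁻¹)(kyk⁻¹)` at `y = 1`; this is what relates conjugation to
left-invariant fields. -/
theorem dConj_comp_dMul (k x : G) : (dConj E k x).comp (dMul E x 1) =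
    (dMul E (k * x * k⁻¹) 1).comp (dConj E k 1) := by
  have h1 : mfderiv 𝓘(ℝ, E) 𝓘(ℝ, E) _ _ = (dConj E k (x * 1)).comp (dMul E x 1) :=
    mfderiv_comp (I' := 𝓘(ℝ, E)) (1 : G) (mdifferentiableAt_conj (E := E) k (x * 1))
    (mdifferentiableAt_mul_left (E := E) x 1)
  have h2 : mfderiv 𝓘(ℝ, E) 𝓘(ℝ, E) _ _ =
      (dMul E (k * x * k⁻¹) (k * 1 * k⁻¹)).comp (dConj E k 1) :=
    mfderiv_comp (I' := 𝓘(ℝ, E)) (1 : G)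
    (mdifferentiableAt_mul_left (E := E) (k * x * k⁻¹) (k * 1 * k⁻¹))
    (mdifferentiableAt_conj (E := E) k 1)
  have e : (fun y : G => k * y * k⁻¹) ∘ (fun y : G => x * y) =
      (fun y : G => (k * x * k⁻¹) * y) ∘ (fun y : G => k * y * k⁻¹) := by
    ext y; simp [mul_assoc]
  have e1 : k * 1 * k⁻¹ = 1 := by simp
  rw [e1] at h2
  rw [mul_one] at h1
  rw [← h1, ← h2]
  rw [e]

theorem dConj_inverse (k x : G) : (dConj E k x).inverse = dConj E k⁻¹ (k * x * k⁻¹) := by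
  apply ContinuousLinearMap.inverse_eq
  · have h := dConj_comp (E := E) k k⁻¹ (k * x * k⁻¹)
    have e : k⁻¹ * (k * x * k⁻¹) * k⁻¹⁻¹ = x := by group
    rwa [e, mul_inv_cancel, dConj_one] at h
  · have h := dConj_comp (E := E) k⁻¹ k x
    rwa [inv_mul_cancel, dConj_one] at h

theorem Ad_Ad (k l : G) (X : GroupLieAlgebra 𝓘(ℝ, E) G) : Ad k (Ad l X) = Ad (k * l) X := by
  have h := dConj_comp (E := E) k l 1
  have e : l * 1 * l⁻¹ = 1 := by simp
  rw [e] at h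
  exact congrArg (fun T : E →L[ℝ] E => T X) h

theorem Ad_inv_Ad (k : G) (X : GroupLieAlgebra 𝓘(ℝ, E) G) : Ad k⁻¹ (Ad k X) = X := by
  rw [Ad_Ad, inv_mul_cancel, Ad_one]

theorem Ad_Ad_inv (k : G) (X : GroupLieAlgebra 𝓘(ℝ, E) G) : Ad k (Ad k⁻¹ X) = X := by
  rw [Ad_Ad, mul_inv_cancel, Ad_one]

theorem mpullback_conj_mulInvariantVectorField (k : G) (v : GroupLieAlgebra 𝓘(ℝ, E) G) :
    VectorField.mpullback 𝓘(ℝ, E) 𝓘(ℝ, E) (fun y : G => k * y * k⁻¹)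
      (mulInvariantVectorField (Ad k v)) = mulInvariantVectorField v := by
  ext x
  have key : ((dConj E k x).inverse.comp ((dMul E (k * x * k⁻¹) 1).comp (dConj E k 1))) =
      dMul E x 1 := by
    rw [← dConj_comp_dMul, ← ContinuousLinearMap.comp_assoc, dConj_inverse, dConj_comp,
      inv_mul_cancel, dConj_one, ContinuousLinearMap.id_comp]
  exact congrArg (fun T : E →L[ℝ] E => T v) key

/-- The bracket of vector fields is natural under pullback, and conjugation pulls left-invariant
fields back to left-invariant fields. -/
theorem Ad_lie [CompleteSpace E] (k : G) (X Y : GroupLieAlgebra 𝓘(ℝ, E) G) :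
    Ad k ⁅X, Y⁆ = ⁅Ad k X, Ad k Y⁆ := by
  have h := VectorField.mpullback_mlieBracket (I := 𝓘(ℝ, E)) (I' := 𝓘(ℝ, E)) (n := ∞) (x₀ := (1 : G))
    (f := fun y : G => k * y * k⁻¹)
    (mdifferentiableAt_mulInvariantVectorField (Ad k X))
    (mdifferentiableAt_mulInvariantVectorField (Ad k Y))
    (contMDiff_conj (E := E) k).contMDiffAt
    (by rw [minSmoothness_of_isRCLikeNormedField]; exact WithTop.coe_le_coe.2 le_top)
  rw [mpullback_conj_mulInvariantVectorField, mpullback_conj_mulInvariantVectorField] at h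
  have e : k * 1 * k⁻¹ = 1 := by simp
  -- Naturality gives the bracket at `k * 1 * k⁻¹`, which is only propositionally `1`; comparing
  -- values in `E` avoids a change of tangent space.
  have h3 : ∀ g : G, g = 1 → (VectorField.mlieBracket 𝓘(ℝ, E) (mulInvariantVectorField (Ad k X))
      (mulInvariantVectorField (Ad k Y)) g : E) =
        (⁅Ad k X, Ad k Y⁆ : GroupLieAlgebra 𝓘(ℝ, E) G) := by
    rintro g rfl; rfl
  have h4 : (dConj E k 1).inverse (⁅Ad k X, Ad k Y⁆ : GroupLieAlgebra 𝓘(ℝ, E) G) =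
      (⁅X, Y⁆ : GroupLieAlgebra 𝓘(ℝ, E) G) := by
    rw [← h3 _ e]; exact h
  rw [dConj_inverse, e] at h4
  rw [← Ad_Ad_inv k (⁅Ad k X, Ad k Y⁆ : GroupLieAlgebra 𝓘(ℝ, E) G)]
  exact congrArg (Ad k) h4.symm

variable [FiniteDimensional ℝ E]

/-- The automorphism `Ad k` of the Lie algebra. -/
noncomputable def adEquiv (k : G) : GroupLieAlgebra 𝓘(ℝ, E) G ≃ₗ⁅ℝ⁆ GroupLieAlgebra 𝓘(ℝ, E) G :=
  { Ad k with
    map_lie' := fun {X Y} => Ad_lie k X Y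
    invFun := Ad k⁻¹
    left_inv := Ad_inv_Ad k
    right_inv := Ad_Ad_inv k }

theorem killingForm_Ad (k : G) (X Y : GroupLieAlgebra 𝓘(ℝ, E) G) :
    killingForm ℝ (GroupLieAlgebra 𝓘(ℝ, E) G) (Ad k X) (Ad k Y) = killingForm ℝ _ X Y :=
  LieAlgebra.killingForm_of_equiv_apply (adEquiv k) X Y

end Adjoint

/-! ### Ricci and scalar curvature of a diagonal metric -/

section RicciFormula

variable {L : Type*} [LieRing L] [LieAlgebra ℝ L] {𝔨 𝔭 : Submodule ℝ L}
  {ι : Type*} [Fintype ι]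

/-- The structure constants `-B([v α, v β], v γ)` of a family of vectors. -/
noncomputable def structureConstants (v : ι → L) (α β γ : ι) : ℝ :=
  -killingForm ℝ L ⁅v α, v β⁆ (v γ)

omit [Fintype ι] in
theorem structureConstants_swap (v : ι → L) (α β γ : ι) :
    structureConstants v α β γ = -structureConstants v β α γ := by
  unfold structureConstants
  rw [← lie_skew (v α) (v β), map_neg, LinearMap.neg_apply]

-- Invariance of the Killing form. Together with `structureConstants_swap` it makes the structure
-- constants totally skew.
omit [Fintype ι] in
theorem structureConstants_rotate (v : ι → L) (α β γ : ι) :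
    structureConstants v α β γ = structureConstants v β γ α := by
  unfold structureConstants
  rw [LieModule.traceForm_apply_lie_apply, LieModule.traceForm_comm]

variable [DecidableEq ι] (h : IsCompl 𝔭 𝔨) (v : Module.Basis ι ℝ 𝔭)

theorem repr_eq_neg_killingForm
    (hv : ∀ α β, -killingForm ℝ L (v α) (v β) = if α = β then 1 else 0) (X : 𝔭) (γ : ι) :
    v.repr X γ = -killingForm ℝ L X (v γ) := by
  conv_rhs => rw [← v.sum_repr X]
  simp only [Submodule.coe_sum, Submodule.coe_smul, map_sum, map_smul, LinearMap.sum_apply,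
    LinearMap.smul_apply, ← Finset.sum_neg_distrib, smul_eq_mul, ← mul_neg, hv]
  simp

theorem repr_adProj (hBk : ∀ Z ∈ 𝔨, ∀ X ∈ 𝔭, killingForm ℝ L Z X = 0)
    (hv : ∀ α β, -killingForm ℝ L (v α) (v β) = if α = β then 1 else 0) (Z : L) (X : 𝔭) (γ : ι) :
    v.repr (adProj h Z X) γ = -killingForm ℝ L ⁅Z, (X : L)⁆ (v γ) := by
  rw [repr_eq_neg_killingForm v hv]
  have e := Submodule.projection_add_projection_eq_self h ⁅Z, (X : L)⁆
  rw [← Submodule.coe_projectionOnto_apply, ← Submodule.coe_projectionOnto_apply] at e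
  conv_rhs => rw [← e]
  rw [map_add, LinearMap.add_apply, hBk _ (Submodule.coe_mem _) _ (Submodule.coe_mem _), add_zero]
  rfl

theorem apply_basis_eq_mul_repr (g : LinearMap.BilinForm ℝ 𝔭) (x : ι → ℝ)
    (hx : ∀ α β, g (v α) (v β) = if α = β then x α else 0) (X : 𝔭) (β : ι) :
    g X (v β) = x β * v.repr X β := by
  conv_lhs => rw [← v.sum_repr X]
  simp only [map_sum, map_smul, LinearMap.sum_apply, LinearMap.smul_apply, smul_eq_mul, hx]
  simp [mul_comm]

theorem basis_apply_eq_mul_repr (g : LinearMap.BilinForm ℝ 𝔭) (x : ι → ℝ)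
    (hx : ∀ α β, g (v α) (v β) = if α = β then x α else 0) (X : 𝔭) (β : ι) :
    g (v β) X = x β * v.repr X β := by
  conv_lhs => rw [← v.sum_repr X]
  simp only [map_sum, map_smul, smul_eq_mul, hx]
  simp [mul_comm]

theorem trace_eq_sum_repr (T : 𝔭 →ₗ[ℝ] 𝔭) :
    LinearMap.trace ℝ 𝔭 T = ∑ α, v.repr (T (v α)) α := by
  rw [LinearMap.trace_eq_matrix_trace ℝ v, Matrix.trace]
  simp [LinearMap.toMatrix_apply]

/-- The `g`-independent part of the Ricci tensor in a basis: the trace of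
`X ↦ [[X, v β]_𝔨, v γ]_𝔭`. -/
noncomputable def isotropyRicci [Module.Finite ℝ L] (β γ : ι) : ℝ :=
  ∑ α, v.repr (adProj h (bracketK h (v α) (v β)) (v γ)) α

/-- The coefficient in the Ricci tensor of a diagonal metric, as a function of the metric
coefficients. -/
noncomputable def ricciWeight (u u' s t : ℝ) : ℝ :=
  -((s + u' - t) * (t + s - u)) / (4 * t * s) + (t + u' - s) / (2 * t)

variable [Module.Finite ℝ L]

/-- Total skewness turns the three terms of the Koszul formula into multiples of a single structure
constant. -/
theorem repr_leviCivita (hBk : ∀ Z ∈ 𝔨, ∀ X ∈ 𝔭, killingForm ℝ L Z X = 0)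
    (hv : ∀ α β, -killingForm ℝ L (v α) (v β) = if α = β then 1 else 0)
    (g : LinearMap.BilinForm ℝ 𝔭) (hg : g.Nondegenerate) (x : ι → ℝ) (hx0 : ∀ α, x α ≠ 0)
    (hx : ∀ α β, g (v α) (v β) = if α = β then x α else 0) (α β γ : ι) :
    v.repr (leviCivita h g hg (v α) (v β)) γ =
      (x γ + x β - x α) / (2 * x γ) * structureConstants (fun α => (v α : L)) α β γ := by
  have e := leviCivita_spec h g hg (v α) (v β) (v γ)
  simp only [apply_basis_eq_mul_repr v g x hx, basis_apply_eq_mul_repr v g x hx,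
    repr_adProj h v hBk hv] at e
  have h1 := structureConstants_swap (fun α => (v α : L)) α γ β
  have h2 := structureConstants_rotate (fun α => (v α : L)) γ α β
  have h3 := structureConstants_rotate (fun α => (v α : L)) α β γ
  simp only [structureConstants] at *
  have := hx0 γ
  field_simp
  linear_combination 2 * e - x β * (h1 - h2) + x α * h3

theorem ricci_basis (hBk : ∀ Z ∈ 𝔨, ∀ X ∈ 𝔭, killingForm ℝ L Z X = 0)
    (hv : ∀ α β, -killingForm ℝ L (v α) (v β) = if α = β then 1 else 0)
    (g : LinearMap.BilinForm ℝ 𝔭) (hg : g.Nondegenerate) (x : ι → ℝ) (hx0 : ∀ α, x α ≠ 0)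
    (hx : ∀ α β, g (v α) (v β) = if α = β then x α else 0) (β γ : ι) :
    ricci h g hg (v β) (v γ) =
      (∑ f, ∑ a, ricciWeight (x β) (x γ) (x f) (x a) *
        (structureConstants (fun α => (v α : L)) β f a *
          structureConstants (fun α => (v α : L)) γ f a)) - isotropyRicci h v β γ := by
  set c := structureConstants (fun α => (v α : L)) with hc
  have hLC := repr_leviCivita h v hBk hv g hg x hx0 hx
  have expand : ∀ (T : 𝔭 →ₗ[ℝ] 𝔭) (X : 𝔭) (a : ι),
      v.repr (T X) a = ∑ f, v.repr X f * v.repr (T (v f)) a := by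
    intro T X a
    conv_lhs => rw [← v.sum_repr X]
    simp only [map_sum, map_smul, Finsupp.coe_finsetSum, Finset.sum_apply, Finsupp.smul_apply,
      smul_eq_mul]
  -- This kills the diagonal entries of the term `Λ(X)Λ(Y)Z` in the trace; the other two connection
  -- terms produce the two summands of `ricciWeight`.
  have hself : ∀ a b, c a b a = 0 := by
    intro a b
    have h1 := structureConstants_rotate (fun α => (v α : L)) a b a
    have h2 := structureConstants_rotate (fun α => (v α : L)) b a a
    have h3 := structureConstants_swap (fun α => (v α : L)) a a b
    simp only [hc]
    linarith
  have key : ∀ a, v.repr (curvature h g hg (v a) (v β) (v γ)) a =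
      (∑ f, ricciWeight (x β) (x γ) (x f) (x a) * (c β f a * c γ f a)) -
        v.repr (adProj h (bracketK h (v a) (v β)) (v γ)) a := by
    intro a
    have t3 : v.repr (leviCivita h g hg (adProj h (v a) (v β)) (v γ)) a =
        ∑ f, v.repr (adProj h (v a) (v β)) f * v.repr (leviCivita h g hg (v f) (v γ)) a :=
      expand ((leviCivita h g hg).flip (v γ)) _ a
    have hp : ∀ f, v.repr (adProj h (v a) (v β)) f = c a β f := fun f =>
      repr_adProj h v hBk hv _ _ _
    simp only [curvature, map_sub, Finsupp.sub_apply]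
    rw [expand (leviCivita h g hg (v a)), expand (leviCivita h g hg (v β)), t3]
    simp only [hLC, hp, ← hc]
    congr 1
    rw [← Finset.sum_sub_distrib, ← Finset.sum_sub_distrib]
    refine Finset.sum_congr rfl fun f _ => ?_
    have e0 := hself a f
    have e1 : c a γ f = c γ f a := structureConstants_rotate _ a γ f
    have e2 : c a β f = c β f a := structureConstants_rotate _ a β f
    have e3 : c f γ a = - c γ f a := structureConstants_swap _ f γ a
    rw [e0, e1, e2, e3, ricciWeight]
    have := hx0 a
    have := hx0 f
    field_simp
    ring
  simp only [ricci, LinearMap.mk₂_apply, trace_eq_sum_repr v]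
  rw [Finset.sum_comm, isotropyRicci, ← Finset.sum_sub_distrib]
  exact Finset.sum_congr rfl fun a _ => key a

theorem scalarCurvature_eq_sum (g : LinearMap.BilinForm ℝ 𝔭) (hg : g.Nondegenerate) (x : ι → ℝ)
    (hx0 : ∀ α, x α ≠ 0) (hx : ∀ α β, g (v α) (v β) = if α = β then x α else 0) :
    scalarCurvature h g hg = ∑ α, ricci h g hg (v α) (v α) / x α := by
  rw [scalarCurvature, trace_eq_sum_repr v]
  refine Finset.sum_congr rfl fun α _ => ?_
  rw [eq_div_iff (hx0 α), mul_comm, ← apply_basis_eq_mul_repr v g x hx]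
  simp

end RicciFormula

/-! ### Orthonormal bases, traces and Schur's lemma -/

section Representation

variable {E : Type*} [NormedAddCommGroup E] [NormedSpace ℝ E] [FiniteDimensional ℝ E]
  {G : Type*} [TopologicalSpace G] [ChartedSpace E G] [Group G] [LieGroup 𝓘(ℝ, E) ∞ G]
  {K : Subgroup G}

local notation "𝔤" => GroupLieAlgebra 𝓘(ℝ, E) G
local notation "κ" => killingForm ℝ (GroupLieAlgebra 𝓘(ℝ, E) G)

namespace IsOrthonormalBasis

variable {ι : Type*} [Fintype ι] [DecidableEq ι]
  {V : Submodule ℝ (GroupLieAlgebra 𝓘(ℝ, E) G)} {e : ι → GroupLieAlgebra 𝓘(ℝ, E) G}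

omit [Fintype ι] in
theorem mem (he : IsOrthonormalBasis V e) (α : ι) : e α ∈ V := by
  rw [← he.1]; exact Submodule.subset_span ⟨α, rfl⟩

theorem sum_eq (he : IsOrthonormalBasis V e) {X : 𝔤} (hX : X ∈ V) :
    ∑ α, (-κ X (e α)) • e α = X := by
  rw [← he.1] at hX
  obtain ⟨w, rfl⟩ := (Submodule.mem_span_range_iff_exists_fun ℝ).1 hX
  refine Finset.sum_congr rfl fun α _ => ?_
  congr 1
  simp only [map_sum, map_smul, LinearMap.sum_apply, LinearMap.smul_apply,
    ← Finset.sum_neg_distrib, smul_eq_mul, ← mul_neg, he.2]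
  simp

theorem eq_of_forall (he : IsOrthonormalBasis V e) {X Y : 𝔤} (hX : X ∈ V) (hY : Y ∈ V)
    (h : ∀ Z ∈ V, -κ X Z = -κ Y Z) : X = Y := by
  rw [← he.sum_eq hX, ← he.sum_eq hY]
  exact Finset.sum_congr rfl fun α _ => by rw [h _ (he.mem α)]

theorem linearIndependent (he : IsOrthonormalBasis V e) : LinearIndependent ℝ e := by
  rw [Fintype.linearIndependent_iff]
  intro w hw β
  have h := congrArg (fun X => -κ X (e β)) hw
  simp only [map_sum, map_smul, LinearMap.sum_apply, LinearMap.smul_apply,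
    ← Finset.sum_neg_distrib, smul_eq_mul, ← mul_neg, he.2] at h
  simpa using h

theorem finrank_eq (he : IsOrthonormalBasis V e) : Module.finrank ℝ V = Fintype.card ι := by
  rw [← he.1]
  exact finrank_span_eq_card he.linearIndependent

omit [Fintype ι] in
theorem Ad (he : IsOrthonormalBasis V e) (hV : IsAdInvariant K V) {k : G} (hk : k ∈ K) :
    IsOrthonormalBasis V (fun α => HomogeneousGeometry.Ad k (e α)) := by
  refine ⟨?_, fun α β => by rw [killingForm_Ad]; exact he.2 α β⟩
  have : (Set.range fun α => HomogeneousGeometry.Ad k (e α)) =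
      HomogeneousGeometry.Ad k '' Set.range e := by
    rw [← Set.range_comp]; rfl
  rw [this, Submodule.span_image, he.1]
  apply le_antisymm
  · rintro _ ⟨X, hX, rfl⟩
    exact hV k hk X hX
  · intro X hX
    exact ⟨HomogeneousGeometry.Ad k⁻¹ X, hV _ (K.inv_mem hk) X hX, Ad_Ad_inv k X⟩

/-- The trace of a bilinear form does not depend on the orthonormal basis. -/
theorem sum_apply_self_eq {e' : ι → 𝔤} (he : IsOrthonormalBasis V e)
    (he' : IsOrthonormalBasis V e') (F : LinearMap.BilinForm ℝ 𝔤) :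
    ∑ α, F (e' α) (e' α) = ∑ α, F (e α) (e α) := by
  have h1 : ∀ α, F (e' α) (e' α) =
      ∑ β, ∑ γ, (κ (e' α) (e β) * κ (e' α) (e γ)) * F (e β) (e γ) := by
    intro α
    conv_lhs => rw [← he.sum_eq (he'.mem α)]
    simp only [map_sum, map_smul, LinearMap.sum_apply, LinearMap.smul_apply, smul_eq_mul,
      Finset.mul_sum]
    rw [Finset.sum_comm]
    exact Finset.sum_congr rfl fun β _ => Finset.sum_congr rfl fun γ _ => by ring
  -- The change-of-basis matrix is orthogonal: expand `e β` in the basis `e'`.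
  have h2 : ∀ β γ, ∑ α, κ (e' α) (e β) * κ (e' α) (e γ) = if β = γ then 1 else 0 := by
    intro β γ
    rw [← he.2 β γ]
    conv_rhs => rw [← he'.sum_eq (he.mem β)]
    simp only [map_sum, map_smul, LinearMap.sum_apply, LinearMap.smul_apply, smul_eq_mul,
      ← Finset.sum_neg_distrib]
    refine Finset.sum_congr rfl fun α _ => ?_
    rw [LieModule.traceForm_comm ℝ 𝔤 𝔤 (e β) (e' α)]
    ring
  calc ∑ α, F (e' α) (e' α)
      = ∑ β, ∑ γ, ∑ α, (κ (e' α) (e β) * κ (e' α) (e γ)) * F (e β) (e γ) := by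
        simp only [h1]
        rw [Finset.sum_comm]
        exact Finset.sum_congr rfl fun β _ => Finset.sum_comm
    _ = _ := by
        simp only [← Finset.sum_mul, h2]
        simp

end IsOrthonormalBasis

/-- The bilinear form
`(X, Y) ↦ ∑_{α,β} B([X, e₁ α], e₂ β) B([Y, e₁ α], e₂ β)`. -/
noncomputable def bracketForm {ι₁ ι₂ : Type*} [Fintype ι₁] [Fintype ι₂] (e₁ : ι₁ → 𝔤) (e₂ : ι₂ → 𝔤) :
    LinearMap.BilinForm ℝ 𝔤 :=
  ∑ α, ∑ β, LinearMap.BilinForm.linMulLin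
    (LinearMap.flip κ (e₂ β) ∘ₗ (LieAlgebra.ad ℝ 𝔤 : 𝔤 →ₗ[ℝ] 𝔤 →ₗ[ℝ] 𝔤).flip (e₁ α))
    (LinearMap.flip κ (e₂ β) ∘ₗ (LieAlgebra.ad ℝ 𝔤 : 𝔤 →ₗ[ℝ] 𝔤 →ₗ[ℝ] 𝔤).flip (e₁ α))

section bracketForm

variable {ι₁ ι₂ : Type*} [Fintype ι₁] [Fintype ι₂] [DecidableEq ι₁] [DecidableEq ι₂]

omit [DecidableEq ι₁] [DecidableEq ι₂] in
theorem bracketForm_apply (e₁ : ι₁ → 𝔤) (e₂ : ι₂ → 𝔤) (X Y : 𝔤) :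
    bracketForm e₁ e₂ X Y = ∑ α, ∑ β, κ ⁅X, e₁ α⁆ (e₂ β) * κ ⁅Y, e₁ α⁆ (e₂ β) := by
  simp only [bracketForm, LinearMap.sum_apply, LinearMap.BilinForm.linMulLin_apply]
  rfl

omit [DecidableEq ι₁] [DecidableEq ι₂] in
theorem bracketForm_symm (e₁ : ι₁ → 𝔤) (e₂ : ι₂ → 𝔤) (X Y : 𝔤) :
    bracketForm e₁ e₂ X Y = bracketForm e₁ e₂ Y X := by
  simp only [bracketForm_apply, mul_comm]

/-- Each of the two sums is a trace over `V₂` or `V₁`, so the bases may be changed one at a time. -/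
theorem bracketForm_congr {V₁ V₂ : Submodule ℝ (GroupLieAlgebra 𝓘(ℝ, E) G)}
    {e₁ e₁' : ι₁ → 𝔤} {e₂ e₂' : ι₂ → 𝔤} (he₁ : IsOrthonormalBasis V₁ e₁)
    (he₁' : IsOrthonormalBasis V₁ e₁') (he₂ : IsOrthonormalBasis V₂ e₂)
    (he₂' : IsOrthonormalBasis V₂ e₂') : bracketForm e₁' e₂' = bracketForm e₁ e₂ := by
  ext X Y
  simp only [bracketForm_apply]
  have h1 : ∀ α, ∑ β, κ ⁅X, e₁' α⁆ (e₂' β) * κ ⁅Y, e₁' α⁆ (e₂' β) =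
      ∑ β, κ ⁅X, e₁' α⁆ (e₂ β) * κ ⁅Y, e₁' α⁆ (e₂ β) := fun α =>
    he₂.sum_apply_self_eq he₂' (LinearMap.BilinForm.linMulLin (κ ⁅X, e₁' α⁆) (κ ⁅Y, e₁' α⁆))
  simp only [h1]
  rw [Finset.sum_comm, Finset.sum_comm (s := (Finset.univ : Finset ι₁))]
  exact Finset.sum_congr rfl fun β _ => he₁.sum_apply_self_eq he₁' (LinearMap.BilinForm.linMulLin
    (LinearMap.flip κ (e₂ β) ∘ₗ LieAlgebra.ad ℝ 𝔤 X) (LinearMap.flip κ (e₂ β) ∘ₗ LieAlgebra.ad ℝ 𝔤 Y))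

/-- Moving both bases by `Ad k` does not change the form, and `Ad k` then factors out of every
bracket as an isometric automorphism. This makes Schur's lemma applicable to the form. -/
theorem bracketForm_Ad {V₁ V₂ : Submodule ℝ (GroupLieAlgebra 𝓘(ℝ, E) G)}
    {e₁ : ι₁ → 𝔤} {e₂ : ι₂ → 𝔤} (he₁ : IsOrthonormalBasis V₁ e₁)
    (he₂ : IsOrthonormalBasis V₂ e₂) (hV₁ : IsAdInvariant K V₁) (hV₂ : IsAdInvariant K V₂)
    {k : G} (hk : k ∈ K) (X Y : 𝔤) :
    bracketForm e₁ e₂ (Ad k X) (Ad k Y) = bracketForm e₁ e₂ X Y := by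
  conv_lhs => rw [← bracketForm_congr he₁ (he₁.Ad hV₁ hk) he₂ (he₂.Ad hV₂ hk)]
  simp only [bracketForm_apply, ← Ad_lie, killingForm_Ad]

omit [DecidableEq ι₁] [DecidableEq ι₂] in
theorem sum_bracketForm {ι : Type*} [Fintype ι] (e : ι → 𝔤) (e₁ : ι₁ → 𝔤) (e₂ : ι₂ → 𝔤) :
    ∑ γ, bracketForm e₁ e₂ (e γ) (e γ) = structuralConstant e e₁ e₂ := by
  simp only [bracketForm_apply, structuralConstant]
  exact Finset.sum_congr rfl fun _ _ => Finset.sum_congr rfl fun _ _ =>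
    Finset.sum_congr rfl fun _ _ => by ring

end bracketForm

/-- Schur's lemma for invariant symmetric bilinear forms on an irreducible subspace. -/
theorem IsAdIrreducible.exists_eq_mul {V : Submodule ℝ (GroupLieAlgebra 𝓘(ℝ, E) G)}
    (hV : IsAdIrreducible K V) {d : ℕ} {e : Fin d → 𝔤} (he : IsOrthonormalBasis V e)
    (β : LinearMap.BilinForm ℝ 𝔤) (hsymm : ∀ X ∈ V, ∀ Y ∈ V, β X Y = β Y X)
    (hinv : ∀ k ∈ K, ∀ X ∈ V, ∀ Y ∈ V, β (Ad k X) (Ad k Y) = β X Y) :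
    ∃ c : ℝ, ∀ X ∈ V, ∀ Y ∈ V, β X Y = c * -κ X Y := by
  obtain ⟨hVinv, hVne, hVirr⟩ := hV
  have hne : Nonempty (Fin d) := by
    by_contra h
    rw [not_nonempty_iff] at h
    apply hVne
    rw [← he.1, Set.range_eq_empty, Submodule.span_empty]
  -- Symmetry supplies a real eigenvalue, so Schur's argument works over `ℝ`; the eigenspace `W`
  -- below is invariant and nonzero, hence all of `V`.
  let A : Matrix (Fin d) (Fin d) ℝ := Matrix.of fun a b => β (e a) (e b)
  have hA : A.IsHermitian := by
    ext a b
    simp [A, hsymm _ (he.mem b) _ (he.mem a)]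
  obtain ⟨j⟩ := hne
  set c := hA.eigenvalues j
  set w : Fin d → ℝ := (hA.eigenvectorBasis j).ofLp
  have hw : A.mulVec w = c • w := hA.mulVec_eigenvectorBasis j
  have hw0 : w ≠ 0 := by
    intro h0
    have := (hA.eigenvectorBasis).orthonormal.ne_zero j
    apply this
    ext a
    exact congrFun h0 a
  let W : Submodule ℝ 𝔤 :=
    { carrier := {X | X ∈ V ∧ ∀ Y ∈ V, β Y X = c * -κ Y X}
      add_mem' := by
        rintro X X' ⟨hX, h⟩ ⟨hX', h'⟩
        refine ⟨V.add_mem hX hX', fun Y hY => ?_⟩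
        rw [map_add, map_add, h Y hY, h' Y hY]; ring
      zero_mem' := ⟨V.zero_mem, fun Y hY => by simp⟩
      smul_mem' := by
        rintro r X ⟨hX, h⟩
        refine ⟨V.smul_mem r hX, fun Y hY => ?_⟩
        rw [map_smul, map_smul, smul_eq_mul, smul_eq_mul, h Y hY]; ring }
  have hWinv : IsAdInvariant K W := by
    rintro k hk X ⟨hX, h⟩
    refine ⟨hVinv k hk X hX, fun Y hY => ?_⟩
    have hY' := hVinv k⁻¹ (K.inv_mem hk) Y hY
    rw [← Ad_Ad_inv k Y, hinv k hk _ hY' _ hX, killingForm_Ad, h _ hY']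
  let X₀ : 𝔤 := ∑ a, w a • e a
  have hX₀ : X₀ ∈ W := by
    refine ⟨V.sum_mem fun a _ => V.smul_mem _ (he.mem a), fun Y hY => ?_⟩
    have hb : ∀ b, β (e b) X₀ = c * -κ (e b) X₀ := by
      intro b
      have h1 : β (e b) X₀ = A.mulVec w b := by
        simp [X₀, A, Matrix.mulVec, dotProduct, mul_comm]
      have h2 : -κ (e b) X₀ = w b := by
        simp only [X₀, map_sum, map_smul, ← Finset.sum_neg_distrib, smul_eq_mul, ← mul_neg, he.2]
        simp
      rw [h1, h2, hw]; rfl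
    rw [← he.sum_eq hY]
    simp only [map_sum, map_smul, LinearMap.sum_apply, LinearMap.smul_apply, hb, smul_eq_mul,
      ← Finset.sum_neg_distrib, Finset.mul_sum]
    exact Finset.sum_congr rfl fun _ _ => by ring
  have hX₀0 : X₀ ≠ 0 := by
    intro h0
    exact hw0 (funext fun a => Fintype.linearIndependent_iff.1 he.linearIndependent w h0 a)
  rcases hVirr W (fun X hX => hX.1) hWinv with h | h
  · rw [h] at hX₀
    exact absurd ((Submodule.mem_bot ℝ).1 hX₀) hX₀0
  · refine ⟨c, fun X hX Y hY => ?_⟩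
    rw [← h] at hY
    exact hY.2 X hX

/-- Schur's lemma for invariant bilinear forms on a pair of inequivalent irreducible subspaces. -/
theorem IsAdIrreducible.apply_eq_zero {V V' : Submodule ℝ (GroupLieAlgebra 𝓘(ℝ, E) G)}
    (hV : IsAdIrreducible K V) (hV' : IsAdInvariant K V') (hne : ¬ AdEquivalent K V V')
    {d d' : ℕ} (hd : d = d')
    {e : Fin d → 𝔤} {e' : Fin d' → 𝔤} (he : IsOrthonormalBasis V e) (he' : IsOrthonormalBasis V' e')
    (β : LinearMap.BilinForm ℝ 𝔤)
    (hinv : ∀ k ∈ K, ∀ X ∈ V, ∀ Y ∈ V', β (Ad k X) (Ad k Y) = β X Y) :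
    ∀ X ∈ V, ∀ Y ∈ V', β X Y = 0 := by
  obtain ⟨hVinv, -, hVirr⟩ := hV
  -- The operator into `V'` that represents `β` with respect to `-κ`; it intertwines the `K`-actions
  -- on `V` and `V'`.
  let T : 𝔤 →ₗ[ℝ] 𝔤 := ∑ a, (LinearMap.flip β (e' a)).smulRight (e' a)
  have hT : ∀ X, T X = ∑ a, β X (e' a) • e' a := fun X => by simp [T]
  have hTmem : ∀ X, T X ∈ V' := fun X => by
    rw [hT]; exact V'.sum_mem fun a _ => V'.smul_mem _ (he'.mem a)
  have hTκ : ∀ X, ∀ Y ∈ V', -κ (T X) Y = β X Y := by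
    intro X Y hY
    conv_rhs => rw [← he'.sum_eq hY]
    simp only [hT, map_sum, map_smul, LinearMap.sum_apply, LinearMap.smul_apply, smul_eq_mul,
      ← Finset.sum_neg_distrib]
    refine Finset.sum_congr rfl fun a _ => ?_
    rw [LieModule.traceForm_comm ℝ 𝔤 𝔤 Y (e' a)]
    ring
  have hTAd : ∀ k ∈ K, ∀ X ∈ V, T (Ad k X) = Ad k (T X) := by
    intro k hk X hX
    refine he'.eq_of_forall (hTmem _) (hV' k hk _ (hTmem X)) fun Y hY => ?_
    have hY' := hV' k⁻¹ (K.inv_mem hk) Y hY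
    rw [hTκ _ _ hY, ← Ad_Ad_inv k Y, hinv k hk X hX _ hY', killingForm_Ad, hTκ _ _ hY']
  let W : Submodule ℝ 𝔤 := V ⊓ LinearMap.ker T
  have hWinv : IsAdInvariant K W := by
    rintro k hk X ⟨hX, h⟩
    refine ⟨hVinv k hk X hX, ?_⟩
    rw [SetLike.mem_coe, LinearMap.mem_ker] at h ⊢
    rw [hTAd k hk X hX, h, map_zero]
  -- If the kernel on `V` is zero, equality of dimensions makes `T` an equivalence, which is
  -- excluded; so `T` vanishes on `V`.
  rcases hVirr W inf_le_left hWinv with h | h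
  · exfalso
    apply hne
    let f : V →ₗ[ℝ] V' := (T.domRestrict V).codRestrict V' fun X => hTmem X
    have hf : Function.Injective f := by
      rw [← LinearMap.ker_eq_bot, LinearMap.ker_eq_bot']
      intro X hX
      have hXW : (X : 𝔤) ∈ W := ⟨X.2, congrArg Subtype.val hX⟩
      rw [h] at hXW
      exact Subtype.ext ((Submodule.mem_bot ℝ).1 hXW)
    have hdim : Module.finrank ℝ V = Module.finrank ℝ V' := by
      rw [he.finrank_eq, he'.finrank_eq, hd]
    refine ⟨LinearEquiv.ofInjectiveOfFinrankEq f hf hdim, fun k hk X Y hXY => ?_⟩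
    change T Y.1 = Ad k (T X.1)
    rw [hXY, hTAd k hk _ X.2]
  · intro X hX Y hY
    have hXW : X ∈ W := by rw [h]; exact hX
    have h0 : T X = 0 := hXW.2
    rw [← hTκ X Y hY, h0]
    simp

end Representation

/-! ### The one-variable variational problem -/

/-- The variational problem for a function of the form `A t - (b / 4) (t³ - 3 t)`, `t = X + X⁻¹`, on a
space parametrized by `X > 0`. -/
theorem max_iff_unique_critical {M : Type*} [TopologicalSpace M] (S : Set M) (X Sc : M → ℝ)
    (P : M → Prop) (g₀ : M) (A b : ℝ) (hb : 0 < b) (hcont : Continuous X) (hXpos : ∀ g, 0 < X g)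
    (hSc : ∀ g ∈ S, Sc g = A * (X g + (X g)⁻¹) -
      b / 4 * ((X g + (X g)⁻¹) ^ 3 - 3 * (X g + (X g)⁻¹)))
    (hP : ∀ g ∈ S, P g ↔ X g = 1 ∨ 3 * b / 4 * ((X g + (X g)⁻¹) ^ 2 - 1) = A)
    (hinj : Set.InjOn X S) (hsurj : ∀ x, 0 < x → ∃ g ∈ S, X g = x)
    (hg₀ : g₀ ∈ S) (hX₀ : X g₀ = 1) :
    (IsMaxOn Sc S g₀ ↔ ∀ g ∈ S, P g → g = g₀) ∧
    (¬ IsMaxOn Sc S g₀ → IsLocalMinOn Sc S g₀ ∧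
      ∃ g₁ ∈ S, ∃ g₂ ∈ S, g₁ ≠ g₂ ∧ g₁ ≠ g₀ ∧ g₂ ≠ g₀ ∧
        {g | g ∈ S ∧ P g} = {g₀, g₁, g₂} ∧ IsMaxOn Sc S g₁ ∧ IsMaxOn Sc S g₂) := by
  have ht : ∀ x : ℝ, 0 < x → 2 ≤ x + x⁻¹ := by
    intro x hx
    have h : x + x⁻¹ - 2 = (x - 1) ^ 2 * x⁻¹ := by field_simp; ring
    have : 0 ≤ (x - 1) ^ 2 * x⁻¹ := by positivity
    linarith
  have hSc₀ : Sc g₀ = A * 2 - b / 4 * 2 := by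
    rw [hSc g₀ hg₀, hX₀]; norm_num
  -- The slope of the cubic at `t = 2` is `A - 9b/4`.
  by_cases hA : 4 * A ≤ 9 * b
  · have hmax : IsMaxOn Sc S g₀ := by
      intro g hg
      change Sc g ≤ Sc g₀
      have h2 := ht _ (hXpos g)
      rw [hSc₀, hSc g hg]
      set t := X g + (X g)⁻¹
      -- The right-hand side is `Sc g₀ - Sc g`, factored at `t = 2`.
      have h3 : 0 ≤ (t - 2) * (b * ((t + 1) ^ 2 - 9) / 4 + (9 * b / 4 - A)) := by
        apply mul_nonneg (by linarith)
        have : 0 ≤ b * ((t + 1) ^ 2 - 9) := mul_nonneg hb.le (by nlinarith)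
        linarith
      nlinarith
    refine ⟨⟨fun _ g hg hPg => hinj hg hg₀ ?_, fun _ => hmax⟩, fun h => absurd hmax h⟩
    rw [hX₀]
    rcases (hP g hg).1 hPg with h | h
    · exact h
    · have h2 := ht _ (hXpos g)
      set t := X g + (X g)⁻¹ with htdef
      have h4 : t = 2 := by
        have : b * (t ^ 2 - 4) ≤ 0 := by linarith
        have : t ^ 2 - 4 ≤ 0 := by
          by_contra hc
          push Not at hc
          nlinarith [mul_pos hb hc]
        nlinarith
      have hx := hXpos g
      rw [htdef] at h4
      field_simp at h4
      nlinarith [sq_nonneg (X g - 1)]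
  · push Not at hA
    -- The positive critical point of the cubic; it exceeds `2` exactly because `4A > 9b`.
    set T := √(1 + 4 * A / (3 * b)) with hT
    have hpos : 4 < 1 + 4 * A / (3 * b) := by
      have : 3 < 4 * A / (3 * b) := by rw [lt_div_iff₀ (by positivity)]; linarith
      linarith
    have hT2 : T ^ 2 = 1 + 4 * A / (3 * b) := Real.sq_sqrt (by linarith)
    have hT4 : 2 < T := by
      rw [hT]; apply Real.lt_sqrt_of_sq_lt; linarith
    have hAT : A = 3 * b / 4 * (T ^ 2 - 1) := by
      rw [hT2]; field_simp; ring
    set r := √(T ^ 2 - 4) with hr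
    have hr2 : r ^ 2 = T ^ 2 - 4 := Real.sq_sqrt (by nlinarith)
    have hr0 : 0 < r := Real.sqrt_pos.2 (by nlinarith)
    -- The larger root of `x + x⁻¹ = T`; the smaller one is `x⁻¹`.
    set x := (T + r) / 2 with hx
    have hx1 : 1 < x := by rw [hx]; linarith
    have hx0 : 0 < x := by linarith
    have hxT : x + x⁻¹ = T := by
      field_simp
      rw [hx]
      linear_combination hr2 / 4
    have hxi : x⁻¹ < 1 := inv_lt_one_of_one_lt₀ hx1
    obtain ⟨g₁, hg₁, hXg₁⟩ := hsurj x hx0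
    obtain ⟨g₂, hg₂, hXg₂⟩ := hsurj x⁻¹ (inv_pos.2 hx0)
    have t₁ : X g₁ + (X g₁)⁻¹ = T := by rw [hXg₁, hxT]
    have t₂ : X g₂ + (X g₂)⁻¹ = T := by rw [hXg₂, inv_inv, add_comm, hxT]
    have hmaxT : ∀ g' ∈ S, X g' + (X g')⁻¹ = T → IsMaxOn Sc S g' := by
      intro g' hg' ht' g hg
      change Sc g ≤ Sc g'
      have h2 := ht _ (hXpos g)
      rw [hSc g hg, hSc g' hg', ht']
      set t := X g + (X g)⁻¹
      -- This product is the value of the cubic at `T` minus its value at `t`: a double root at the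
      -- critical point.
      have : 0 ≤ b / 4 * ((t - T) ^ 2 * (t + 2 * T)) := by
        have : 0 ≤ t + 2 * T := by linarith
        positivity
      rw [hAT]
      linarith
    have h12 : g₁ ≠ g₂ := by
      rintro rfl
      rw [hXg₁] at hXg₂; linarith
    have h10 : g₁ ≠ g₀ := by
      rintro rfl
      rw [hXg₁] at hX₀; linarith
    have h20 : g₂ ≠ g₀ := by
      rintro rfl
      rw [hXg₂] at hX₀; linarith
    have hP₁ : P g₁ := (hP g₁ hg₁).2 (Or.inr (by rw [t₁]; exact hAT.symm))
    have hP₂ : P g₂ := (hP g₂ hg₂).2 (Or.inr (by rw [t₂]; exact hAT.symm))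
    have hnmax : ¬ IsMaxOn Sc S g₀ := by
      intro h
      have h1 : Sc g₁ ≤ Sc g₀ := h hg₁
      rw [hSc₀, hSc g₁ hg₁, t₁, hAT] at h1
      have : 0 < b / 4 * ((2 - T) ^ 2 * (2 + 2 * T)) := by
        have : 0 < 2 + 2 * T := by linarith
        have : (2 - T) ≠ 0 := by linarith
        positivity
      linarith
    refine ⟨⟨fun h => absurd h hnmax, fun h => absurd (h g₁ hg₁ hP₁) h10⟩, fun _ => ⟨?_, g₁, hg₁,
      g₂, hg₂, h12, h10, h20, ?_, hmaxT g₁ hg₁ t₁, hmaxT g₂ hg₂ t₂⟩⟩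
    -- `Sc g - Sc g₀ = (t - 2)(A - (b/4)(t + 1)²)`, whose second factor is positive at `t = 2` and
    -- so, by continuity, near `g₀`.
    · have hc : ContinuousAt (fun g => b / 4 * (X g + (X g)⁻¹ + 1) ^ 2) g₀ := by
        have := hcont.continuousAt (x := g₀)
        exact (((this.add (this.inv₀ (hXpos g₀).ne')).add_const 1).pow 2).const_mul _
      have hlt : b / 4 * (X g₀ + (X g₀)⁻¹ + 1) ^ 2 < A := by
        rw [hX₀]; norm_num; linarith
      have hev := hc.eventually (gt_mem_nhds hlt)
      filter_upwards [nhdsWithin_le_nhds hev, self_mem_nhdsWithin] with g hg hgS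
      change Sc g₀ ≤ Sc g
      have h2 := ht _ (hXpos g)
      rw [hSc₀, hSc g hgS]
      set t := X g + (X g)⁻¹
      have : 0 ≤ (t - 2) * (A - b / 4 * (t + 1) ^ 2) := mul_nonneg (by linarith) (by linarith)
      linarith
    · ext g
      constructor
      · rintro ⟨hg, hPg⟩
        rcases (hP g hg).1 hPg with h | h
        · exact Or.inl (hinj hg hg₀ (by rw [h, hX₀]))
        · have h2 := ht _ (hXpos g)
          have hgT : X g + (X g)⁻¹ = T := by
            have h5 : 3 * b / 4 * ((X g + (X g)⁻¹) ^ 2 - T ^ 2) = 0 := by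
              rw [hAT] at h; linarith
            have h6 : (X g + (X g)⁻¹) ^ 2 - T ^ 2 = 0 :=
              (mul_eq_zero.1 h5).resolve_left (by positivity)
            nlinarith
          have hXg := hXpos g
          -- `X g` is a root of `z² - Tz + 1`, whose roots are `x` and `x⁻¹`.
          have h7 : (X g - x) * (X g - x⁻¹) = 0 := by
            have e1 : X g * (X g)⁻¹ = 1 := mul_inv_cancel₀ hXg.ne'
            have e2 : x * x⁻¹ = 1 := mul_inv_cancel₀ hx0.ne'
            linear_combination X g * hgT - X g * hxT - e1 + e2
          rcases mul_eq_zero.1 h7 with h8 | h8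
          · exact Or.inr (Or.inl (hinj hg hg₁ (by rw [hXg₁]; linarith)))
          · exact Or.inr (Or.inr (hinj hg hg₂ (by rw [hXg₂]; linarith)))
      · rintro (rfl | rfl | rfl)
        · exact ⟨hg₀, (hP _ hg₀).2 (Or.inl hX₀)⟩
        · exact ⟨hg₁, hP₁⟩
        · exact ⟨hg₂, hP₂⟩

/-! ### Invariant metrics as pairs of coefficients -/

section TwoSummands

variable {E : Type*} [NormedAddCommGroup E] [NormedSpace ℝ E] [FiniteDimensional ℝ E]
  {G : Type*} [TopologicalSpace G] [ChartedSpace E G] [Group G] [LieGroup 𝓘(ℝ, E) ∞ G]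
  {K : Subgroup G} {D : ReductiveDecomposition E K}

local notation "𝔤" => GroupLieAlgebra 𝓘(ℝ, E) G
local notation "κ" => killingForm ℝ (GroupLieAlgebra 𝓘(ℝ, E) G)

/-- An orthonormal basis as a basis of the subspace. -/
noncomputable def IsOrthonormalBasis.basis {ι : Type*} [Fintype ι] [DecidableEq ι]
    {V : Submodule ℝ (GroupLieAlgebra 𝓘(ℝ, E) G)} {e : ι → 𝔤} (he : IsOrthonormalBasis V e) :
    Module.Basis ι ℝ V :=
  (Module.Basis.span he.linearIndependent).map (LinearEquiv.ofEq _ _ he.1)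

theorem IsOrthonormalBasis.coe_basis {ι : Type*} [Fintype ι] [DecidableEq ι]
    {V : Submodule ℝ (GroupLieAlgebra 𝓘(ℝ, E) G)} {e : ι → 𝔤} (he : IsOrthonormalBasis V e)
    (α : ι) : (he.basis α : 𝔤) = e α := by
  simp [IsOrthonormalBasis.basis, Module.Basis.span_apply]

theorem IsIsotropyDecomposition.le {r : ℕ} {V : Fin r → Submodule ℝ (GroupLieAlgebra 𝓘(ℝ, E) G)}
    (hV : IsIsotropyDecomposition D V) (i : Fin r) : V i ≤ D.𝔭 := by
  rw [← hV.iSup_eq]; exact le_iSup V i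

theorem IsIsotropyDecomposition.isOrthonormalBasis {r : ℕ}
    {V : Fin r → Submodule ℝ (GroupLieAlgebra 𝓘(ℝ, E) G)} (hV : IsIsotropyDecomposition D V)
    {d : Fin r → ℕ} {e : ∀ i, Fin (d i) → 𝔤} (he : ∀ i, IsOrthonormalBasis (V i) (e i)) :
    IsOrthonormalBasis D.𝔭 (fun s : (i : Fin r) × Fin (d i) => e s.1 s.2) := by
  constructor
  · rw [Set.range_sigma_eq_iUnion_range, Submodule.span_iUnion, ← hV.iSup_eq]
    exact iSup_congr fun i => (he i).1
  · rintro ⟨i, a⟩ ⟨j, b⟩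
    by_cases hij : i = j
    · subst hij
      rw [(he i).2]
      simp
    · rw [hV.orthogonal i j hij _ ((he i).mem a) _ ((he j).mem b)]
      simp [hij]

theorem IsAdIrreducible.card_pos {V : Submodule ℝ (GroupLieAlgebra 𝓘(ℝ, E) G)}
    (hV : IsAdIrreducible K V) {d : ℕ} {e : Fin d → 𝔤} (he : IsOrthonormalBasis V e) : 0 < d := by
  rcases Nat.eq_zero_or_pos d with rfl | h
  · exact absurd (by rw [← he.1, Set.range_eq_empty, Submodule.span_empty]) hV.2.1
  · exact h

variable {V : Fin 2 → Submodule ℝ (GroupLieAlgebra 𝓘(ℝ, E) G)} {d : Fin 2 → ℕ}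
  {e : ∀ i, Fin (d i) → GroupLieAlgebra 𝓘(ℝ, E) G}

/-- An invariant symmetric bilinear form on `𝔭` is a multiple of the Killing form on each of the
two isotropy summands. -/
theorem IsIsotropyDecomposition.exists_diagonal (hV : IsIsotropyDecomposition D V)
    (he : ∀ i, IsOrthonormalBasis (V i) (e i)) (hd : d 0 = d 1)
    (β : LinearMap.BilinForm ℝ 𝔤) (hsymm : ∀ X ∈ D.𝔭, ∀ Y ∈ D.𝔭, β X Y = β Y X)
    (hinv : ∀ k ∈ K, ∀ X ∈ D.𝔭, ∀ Y ∈ D.𝔭, β (Ad k X) (Ad k Y) = β X Y) :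
    ∃ c : Fin 2 → ℝ, ∀ s t : (i : Fin 2) × Fin (d i),
      β (e s.1 s.2) (e t.1 t.2) = if s = t then c s.1 else 0 := by
  choose c hc using fun i => (hV.irreducible i).exists_eq_mul (he i) β
    (fun X hX Y hY => hsymm X (hV.le i hX) Y (hV.le i hY))
    (fun k hk X hX Y hY => hinv k hk X (hV.le i hX) Y (hV.le i hY))
  have h01 := (hV.irreducible 0).apply_eq_zero (hV.irreducible 1).1
    (hV.inequivalent 0 1 (by decide)) hd (he 0) (he 1) β
    (fun k hk X hX Y hY => hinv k hk X (hV.le 0 hX) Y (hV.le 1 hY))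
  refine ⟨c, ?_⟩
  rintro ⟨i, a⟩ ⟨j, b⟩
  by_cases hij : i = j
  · subst hij
    rw [hc i _ ((he i).mem a) _ ((he i).mem b), (he i).2]
    simp
  · rw [if_neg (fun h => hij (congrArg Sigma.fst h))]
    have hcases : i = 0 ∧ j = 1 ∨ i = 1 ∧ j = 0 := by omega
    rcases hcases with ⟨rfl, rfl⟩ | ⟨rfl, rfl⟩
    · exact h01 _ ((he 0).mem a) _ ((he 1).mem b)
    · rw [hsymm _ (hV.le 1 ((he 1).mem a)) _ (hV.le 0 ((he 0).mem b))]
      exact h01 _ ((he 0).mem b) _ ((he 1).mem a)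

/-- The basis of `𝔭` made of the orthonormal bases of the summands. -/
noncomputable abbrev IsIsotropyDecomposition.basis (hV : IsIsotropyDecomposition D V)
    (he : ∀ i, IsOrthonormalBasis (V i) (e i)) :
    Module.Basis ((i : Fin 2) × Fin (d i)) ℝ D.𝔭 :=
  (hV.isOrthonormalBasis he).basis

theorem IsIsotropyDecomposition.coe_basis (hV : IsIsotropyDecomposition D V)
    (he : ∀ i, IsOrthonormalBasis (V i) (e i)) (s : (i : Fin 2) × Fin (d i)) :
    (hV.basis he s : 𝔤) = e s.1 s.2 :=
  (hV.isOrthonormalBasis he).coe_basis s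

/-- `g` has the coefficients `x 0`, `x 1` on the two summands, with respect to the Killing metric. -/
def HasCoefficients (g : InvariantMetric D) (v : Module.Basis ((i : Fin 2) × Fin (d i)) ℝ D.𝔭)
    (x : Fin 2 → ℝ) : Prop :=
  ∀ s t, g.form (v s) (v t) = if s = t then x s.1 else 0

theorem InvariantMetric.exists_hasCoefficients (g : InvariantMetric D)
    (hV : IsIsotropyDecomposition D V) (he : ∀ i, IsOrthonormalBasis (V i) (e i))
    (hd : d 0 = d 1) : ∃ x, HasCoefficients g (hV.basis he) x := by
  -- Extends the metric to a form on `𝔤`, where the Schur lemmas are stated; only its values on `𝔭`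
  -- matter.
  let P := D.𝔭.projectionOnto (lieAlgebraOf E K) D.isCompl
  have hP : ∀ X (hX : X ∈ D.𝔭), P X = ⟨X, hX⟩ := fun X hX =>
    Submodule.projectionOnto_apply_left D.isCompl ⟨X, hX⟩
  obtain ⟨c, hc⟩ := hV.exists_diagonal he hd (g.form.compl₁₂ P P)
    (fun X _ Y _ => g.symm _ _) (by
      intro k hk X hX Y hY
      simp only [LinearMap.compl₁₂_apply]
      rw [hP X hX, hP Y hY, hP _ (D.Ad_mem k hk X hX), hP _ (D.Ad_mem k hk Y hY)]
      exact g.invariant k hk ⟨X, hX⟩ ⟨Y, hY⟩)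
  refine ⟨c, fun s t => ?_⟩
  rw [← hc s t, LinearMap.compl₁₂_apply, ← hV.coe_basis he, ← hV.coe_basis he,
    hP _ (Submodule.coe_mem _), hP _ (Submodule.coe_mem _)]

omit [FiniteDimensional ℝ E] [LieGroup 𝓘(ℝ, E) ∞ G] in
theorem HasCoefficients.pos {g : InvariantMetric D}
    {v : Module.Basis ((i : Fin 2) × Fin (d i)) ℝ D.𝔭} {x : Fin 2 → ℝ}
    (h : HasCoefficients g v x) (hd : ∀ i, 0 < d i) (i : Fin 2) : 0 < x i := by
  have h1 := h ⟨i, ⟨0, hd i⟩⟩ ⟨i, ⟨0, hd i⟩⟩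
  rw [if_pos rfl] at h1
  rw [← h1]
  exact g.pos _ (v.ne_zero _)

omit [FiniteDimensional ℝ E] [LieGroup 𝓘(ℝ, E) ∞ G] in
theorem HasCoefficients.unique {g : InvariantMetric D}
    {v : Module.Basis ((i : Fin 2) × Fin (d i)) ℝ D.𝔭} {x y : Fin 2 → ℝ}
    (hx : HasCoefficients g v x) (hy : HasCoefficients g v y) (hd : ∀ i, 0 < d i) : x = y := by
  funext i
  have h1 := hx ⟨i, ⟨0, hd i⟩⟩ ⟨i, ⟨0, hd i⟩⟩
  rw [hy, if_pos rfl, if_pos rfl] at h1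
  exact h1.symm

omit [FiniteDimensional ℝ E] [LieGroup 𝓘(ℝ, E) ∞ G] in
theorem HasCoefficients.eq {g g' : InvariantMetric D}
    {v : Module.Basis ((i : Fin 2) × Fin (d i)) ℝ D.𝔭} {x : Fin 2 → ℝ}
    (h : HasCoefficients g v x) (h' : HasCoefficients g' v x) : g = g' := by
  apply InvariantMetric.ext
  exact LinearMap.BilinForm.ext_basis v fun s t => by rw [h, h']

theorem InvariantMetric.IsStandard.hasCoefficients {gB : InvariantMetric D} (hgB : gB.IsStandard)
    (hV : IsIsotropyDecomposition D V) (he : ∀ i, IsOrthonormalBasis (V i) (e i)) :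
    HasCoefficients gB (hV.basis he) fun _ => 1 := by
  intro s t
  rw [hgB.2, hV.coe_basis, hV.coe_basis]
  exact (hV.isOrthonormalBasis he).2 s t

/-- The invariant metric with given coefficients on the two summands. -/
theorem exists_invariantMetric (hV : IsIsotropyDecomposition D V)
    (he : ∀ i, IsOrthonormalBasis (V i) (e i)) (x : Fin 2 → ℝ) (hx : ∀ i, 0 < x i) :
    ∃ g : InvariantMetric D, HasCoefficients g (hV.basis he) x := by
  -- `F i` is `-κ` on `V i` and zero on the other summand. Being a sum of squares makes positivity
  -- visible.
  let F : Fin 2 → LinearMap.BilinForm ℝ 𝔤 := fun i =>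
    ∑ a, LinearMap.BilinForm.linMulLin (LinearMap.flip κ (e i a)) (LinearMap.flip κ (e i a))
  have hF : ∀ i X Y, F i X Y = ∑ a, κ X (e i a) * κ Y (e i a) := by
    intro i X Y
    simp only [F, LinearMap.sum_apply, LinearMap.BilinForm.linMulLin_apply]
    rfl
  let B : LinearMap.BilinForm ℝ 𝔤 := ∑ i, x i • F i
  have hB : ∀ X Y, B X Y = ∑ i, x i * ∑ a, κ X (e i a) * κ Y (e i a) := by
    intro X Y
    simp only [B, LinearMap.sum_apply, LinearMap.smul_apply, hF, smul_eq_mul]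
  have hsum := fun X => (hV.isOrthonormalBasis he).sum_eq (X := X)
  have hnn : ∀ (X : 𝔤) i, 0 ≤ x i * ∑ a, κ X (e i a) * κ X (e i a) := fun X i =>
    mul_nonneg (hx i).le (Finset.sum_nonneg fun a _ => mul_self_nonneg _)
  let g : InvariantMetric D :=
    { form := B.compl₁₂ D.𝔭.subtype D.𝔭.subtype
      symm := by
        intro X Y
        simp only [LinearMap.compl₁₂_apply, hB, mul_comm]
      pos := by
        intro X hX
        simp only [LinearMap.compl₁₂_apply, hB]
        refine lt_of_le_of_ne (Finset.sum_nonneg fun i _ => hnn _ i) fun h0 => hX ?_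
        have h1 := (Finset.sum_eq_zero_iff_of_nonneg fun i _ => hnn _ i).1 h0.symm
        have h2 : ∀ i a, κ X (e i a) = 0 := by
          intro i a
          have h3 := (mul_eq_zero.1 (h1 i (Finset.mem_univ _))).resolve_left (hx i).ne'
          have h4 := (Finset.sum_eq_zero_iff_of_nonneg fun a _ => mul_self_nonneg _).1 h3 a
            (Finset.mem_univ _)
          exact mul_self_eq_zero.1 h4
        apply Subtype.ext
        rw [← hsum X X.2]
        exact Finset.sum_eq_zero fun s _ => by rw [h2, neg_zero, zero_smul]
      invariant := by
        intro k hk X Y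
        simp only [LinearMap.compl₁₂_apply, hB]
        refine Finset.sum_congr rfl fun i _ => ?_
        congr 1
        -- The sum is a trace over `V i`, so the basis may be moved by `Ad k` together with `X` and
        -- `Y`.
        have h := (he i).sum_apply_self_eq ((he i).Ad (hV.irreducible i).1 hk)
          (LinearMap.BilinForm.linMulLin (κ (Ad k X)) (κ (Ad k Y)))
        simp only [LinearMap.BilinForm.linMulLin_apply, killingForm_Ad] at h
        exact h.symm }
  refine ⟨g, fun s t => ?_⟩
  change B (hV.basis he s) (hV.basis he t) = _
  have h1 : ∀ i a (t : (i : Fin 2) × Fin (d i)), κ (e t.1 t.2) (e i a) =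
      - if t = ⟨i, a⟩ then 1 else 0 := by
    intro i a t
    rw [← (hV.isOrthonormalBasis he).2, neg_neg]
  rw [hV.coe_basis, hV.coe_basis, hB]
  simp only [h1, Finset.mul_sum]
  rw [← Fintype.sum_sigma' (fun i a => x i * ((-if s = ⟨i, a⟩ then 1 else 0) *
    (-if t = ⟨i, a⟩ then 1 else 0)))]
  simp only [Sigma.eta, neg_mul_neg, mul_ite, mul_one, mul_zero]
  rw [Finset.sum_eq_single s]
  · simp [eq_comm]
  · intro u _ hu
    simp [hu.symm]
  · simp

omit [LieGroup 𝓘(ℝ, E) ∞ G] in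
/-- The volume condition in terms of the coefficients. -/
theorem HasCoefficients.volDensity_eq_iff {g gB : InvariantMetric D}
    {v : Module.Basis ((i : Fin 2) × Fin (d i)) ℝ D.𝔭} {x : Fin 2 → ℝ}
    (h : HasCoefficients g v x) (hB : HasCoefficients gB v fun _ => 1) (hd : d 0 = d 1)
    (hpos : ∀ i, 0 < d i) : g.volDensity = gB.volDensity ↔ x 0 * x 1 = 1 := by
  have hxpos := h.pos hpos
  let σ : ((i : Fin 2) × Fin (d i)) ≃ Fin (Module.finrank ℝ D.𝔭) :=
    v.indexEquiv (Module.finBasis ℝ D.𝔭)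
  let w := v.reindex σ
  -- Passing to the adapted basis costs a squared determinant independent of the metric, which
  -- cancels in the comparison; `d 0 = d 1` merges the two powers.
  have hdet : ∀ (g : InvariantMetric D) (x : Fin 2 → ℝ), HasCoefficients g v x →
      (LinearMap.BilinForm.toMatrix (Module.finBasis ℝ D.𝔭) g.form).det =
        (w.toMatrix (Module.finBasis ℝ D.𝔭)).det ^ 2 * (x 0 * x 1) ^ d 0 := by
    intro g x h
    rw [← LinearMap.BilinForm.toMatrix_mul_basis_toMatrix w, Matrix.det_mul, Matrix.det_mul,
      Matrix.det_transpose]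
    have h1 : LinearMap.BilinForm.toMatrix w g.form =
        Matrix.diagonal fun j => x (σ.symm j).1 := by
      ext i j
      rw [LinearMap.BilinForm.toMatrix_apply, Matrix.diagonal_apply]
      simp only [w, Module.Basis.reindex_apply, h (σ.symm i) (σ.symm j), EmbeddingLike.apply_eq_iff_eq]
    have h2 : ∏ j, x (σ.symm j).1 = (x 0 * x 1) ^ d 0 := by
      rw [Equiv.prod_comp σ.symm (fun s => x s.1), Fintype.prod_sigma, Fin.prod_univ_two]
      simp [mul_pow, hd]
    rw [h1, Matrix.det_diagonal, h2]
    ring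
  have hC : 0 < (w.toMatrix (Module.finBasis ℝ D.𝔭)).det ^ 2 := by
    have := Module.Basis.invertibleToMatrix w (Module.finBasis ℝ D.𝔭)
    have hne := (Matrix.isUnit_det_of_invertible (w.toMatrix (Module.finBasis ℝ D.𝔭))).ne_zero
    positivity
  have hx01 : 0 < x 0 * x 1 := mul_pos (hxpos 0) (hxpos 1)
  rw [InvariantMetric.volDensity, InvariantMetric.volDensity, hdet g x h, hdet gB _ hB,
    Real.sqrt_inj (by positivity) (by positivity), mul_right_inj' hC.ne', mul_one, one_pow,
    pow_eq_one_iff_of_nonneg hx01.le (hpos 0).ne']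

end TwoSummands

/-! ### Symmetry of the structural constants -/

section StructuralConstants

variable {L : Type*} [LieRing L] [LieAlgebra ℝ L]
  {ι₁ ι₂ ι₃ : Type*} [Fintype ι₁] [Fintype ι₂] [Fintype ι₃]

theorem structuralConstant_swap (e₁ : ι₁ → L) (e₂ : ι₂ → L) (e₃ : ι₃ → L) :
    structuralConstant e₁ e₂ e₃ = structuralConstant e₂ e₁ e₃ := by
  unfold structuralConstant
  rw [Finset.sum_comm]
  refine Finset.sum_congr rfl fun β _ => Finset.sum_congr rfl fun α _ =>
    Finset.sum_congr rfl fun γ _ => ?_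
  rw [← lie_skew (e₁ α) (e₂ β), map_neg, LinearMap.neg_apply]
  ring

theorem structuralConstant_rotate (e₁ : ι₁ → L) (e₂ : ι₂ → L) (e₃ : ι₃ → L) :
    structuralConstant e₁ e₂ e₃ = structuralConstant e₂ e₃ e₁ := by
  unfold structuralConstant
  rw [Finset.sum_comm]
  refine Finset.sum_congr rfl fun β _ => ?_
  rw [Finset.sum_comm]
  refine Finset.sum_congr rfl fun γ _ => Finset.sum_congr rfl fun α _ => ?_
  rw [LieModule.traceForm_apply_lie_apply, LieModule.traceForm_comm]

end StructuralConstants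

/-! ### Curvature in terms of the two coefficients -/

section TwoSummands

variable {E : Type*} [NormedAddCommGroup E] [NormedSpace ℝ E] [FiniteDimensional ℝ E]
  {G : Type*} [TopologicalSpace G] [ChartedSpace E G] [Group G] [LieGroup 𝓘(ℝ, E) ∞ G]
  {K : Subgroup G} {D : ReductiveDecomposition E K}
  {V : Fin 2 → Submodule ℝ (GroupLieAlgebra 𝓘(ℝ, E) G)} {d : Fin 2 → ℕ}
  {e : ∀ i, Fin (d i) → GroupLieAlgebra 𝓘(ℝ, E) G}

/-- The Ricci tensor of an invariant metric on the summand `i`, relative to the Killing metric; `ρ` is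
the Einstein constant of the Killing metric, and `c j k i` is the value of
`bracketForm (e j) (e k)` on the summand `i`. -/
noncomputable def ricciCoefficient (ρ : ℝ) (c : Fin 2 → Fin 2 → Fin 2 → ℝ) (x : Fin 2 → ℝ)
    (i : Fin 2) : ℝ :=
  ρ + ∑ j, ∑ k, (ricciWeight (x i) (x i) (x j) (x k) - 1 / 4) * c j k i

/-- The formula is subtracted from its instance for `gB`, where all weights are `1/4` and the Ricci
tensor is known. This removes `isotropyRicci`, on and off the diagonal, without computing it. -/
theorem HasCoefficients.ric_basis {g gB : InvariantMetric D} (hgB : gB.IsStandard)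
    (hV : IsIsotropyDecomposition D V) (he : ∀ i, IsOrthonormalBasis (V i) (e i))
    (hpos : ∀ i, 0 < d i) {ρ : ℝ} (hρ : gB.ric = ρ • gB.form)
    {c : Fin 2 → Fin 2 → Fin 2 → ℝ}
    (hc : ∀ j k (s t : (i : Fin 2) × Fin (d i)), bracketForm (e j) (e k) (e s.1 s.2) (e t.1 t.2) =
      if s = t then c j k s.1 else 0)
    {x : Fin 2 → ℝ} (hx : HasCoefficients g (hV.basis he) x) (s t : (i : Fin 2) × Fin (d i)) :
    g.ric (hV.basis he s) (hV.basis he t) = if s = t then ricciCoefficient ρ c x s.1 else 0 := by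
  have hv := (hV.isOrthonormalBasis he).2
  simp only [← hV.coe_basis he] at hv
  have formula : ∀ (g : InvariantMetric D) (x : Fin 2 → ℝ), HasCoefficients g (hV.basis he) x →
      g.ric (hV.basis he s) (hV.basis he t) =
        (∑ j, ∑ k, ricciWeight (x s.1) (x t.1) (x j) (x k) * if s = t then c j k s.1 else 0) -
          isotropyRicci D.isCompl (hV.basis he) s t := by
    intro g x hx
    rw [InvariantMetric.ric, ricci_basis D.isCompl (hV.basis he) hgB.1 hv g.form g.nondegenerate
      (fun s => x s.1) (fun s => (hx.pos hpos s.1).ne') hx]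
    congr 1
    simp only [← hc, bracketForm_apply, structureConstants, hV.coe_basis, Fintype.sum_sigma,
      neg_mul_neg, Finset.mul_sum]
    exact Finset.sum_congr rfl fun j _ => Finset.sum_comm
  have hB := formula gB _ (hgB.hasCoefficients hV he)
  rw [hρ, LinearMap.smul_apply, LinearMap.smul_apply, hgB.hasCoefficients hV he s t,
    smul_eq_mul] at hB
  rw [formula g x hx]
  by_cases hst : s = t
  · subst hst
    simp only [if_pos] at hB ⊢
    have hw : ricciWeight 1 1 1 1 = 1 / 4 := by norm_num [ricciWeight]
    simp only [hw, Fin.sum_univ_two] at hB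
    simp only [ricciCoefficient, Fin.sum_univ_two]
    linarith
  · simp only [if_neg hst] at hB ⊢
    simp only [mul_zero, Finset.sum_const_zero] at hB ⊢
    linarith

theorem InvariantMetric.scal_eq {g : InvariantMetric D}
    {v : Module.Basis ((i : Fin 2) × Fin (d i)) ℝ D.𝔭} {x r : Fin 2 → ℝ}
    (hx : HasCoefficients g v x) (hpos : ∀ i, 0 < d i)
    (hr : ∀ s t, g.ric (v s) (v t) = if s = t then r s.1 else 0) :
    g.scal = d 0 * (r 0 / x 0) + d 1 * (r 1 / x 1) := by
  rw [InvariantMetric.scal, scalarCurvature_eq_sum D.isCompl v g.form g.nondegenerate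
    (fun s => x s.1) (fun s => (hx.pos hpos s.1).ne') hx]
  have h : ∀ s, ricci D.isCompl g.form g.nondegenerate (v s) (v s) = r s.1 := fun s => by
    have := hr s s
    rwa [if_pos rfl] at this
  simp only [h, Fintype.sum_sigma, Fin.sum_univ_two]
  simp

theorem InvariantMetric.isEinstein_iff {g : InvariantMetric D}
    {v : Module.Basis ((i : Fin 2) × Fin (d i)) ℝ D.𝔭} {x r : Fin 2 → ℝ}
    (hx : HasCoefficients g v x) (hpos : ∀ i, 0 < d i)
    (hr : ∀ s t, g.ric (v s) (v t) = if s = t then r s.1 else 0) :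
    g.IsEinstein ↔ r 0 / x 0 = r 1 / x 1 := by
  constructor
  · rintro ⟨ρ, hρ⟩
    have h : ∀ i, r i / x i = ρ := by
      intro i
      have h1 := hr ⟨i, ⟨0, hpos i⟩⟩ ⟨i, ⟨0, hpos i⟩⟩
      rw [hρ, LinearMap.smul_apply, LinearMap.smul_apply, hx, if_pos rfl, if_pos rfl,
        smul_eq_mul] at h1
      rw [← h1, mul_div_assoc, div_self (hx.pos hpos i).ne', mul_one]
    rw [h, h]
  · intro h
    refine ⟨r 0 / x 0, LinearMap.BilinForm.ext_basis v fun s t => ?_⟩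
    have h' : ∀ i, r i = r 0 / x 0 * x i := by
      intro i
      have hi := (hx.pos hpos i).ne'
      fin_cases i
      · exact (div_mul_cancel₀ _ hi).symm
      · change r 1 = _ * x 1
        rw [h]; exact (div_mul_cancel₀ _ hi).symm
    rw [hr, LinearMap.smul_apply, LinearMap.smul_apply, hx, smul_eq_mul, h' s.1]
    split_ifs <;> simp

omit [FiniteDimensional ℝ E] [LieGroup 𝓘(ℝ, E) ∞ G] in
theorem InvariantMetric.continuous_form_apply (X Y : D.𝔭) :
    Continuous fun g : InvariantMetric D => g.form X Y :=
  have h : Continuous fun (g : InvariantMetric D) (X Y : D.𝔭) => g.form X Y := continuous_induced_dom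
  (continuous_apply Y).comp ((continuous_apply X).comp h)

end TwoSummands

end HomogeneousGeometry

/-! ### Reduction of the theorem to the one-variable problem -/

open HomogeneousGeometry in
theorem lemma5p2
    {E : Type*} [NormedAddCommGroup E] [NormedSpace ℝ E] [FiniteDimensional ℝ E]
    {G : Type*} [TopologicalSpace G] [ChartedSpace E G] [Group G] [LieGroup 𝓘(ℝ, E) ∞ G]
    [CompactSpace G] [LieAlgebra.IsSemisimple ℝ (GroupLieAlgebra 𝓘(ℝ, E) G)]
    (K : Subgroup G) (hK : IsClosed (K : Set G))
    -- the standard metric `g_B`, the two isotropy summands `𝔭₁ = V 0`, `𝔭₂ = V 1`, and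
    -- orthonormal bases of them
    (D : ReductiveDecomposition E K) (gB : InvariantMetric D) (hgB : gB.IsStandard)
    (V : Fin 2 → Submodule ℝ (GroupLieAlgebra 𝓘(ℝ, E) G)) (hV : IsIsotropyDecomposition D V)
    (d : Fin 2 → ℕ) (e : ∀ i, Fin (d i) → GroupLieAlgebra 𝓘(ℝ, E) G)
    (he : ∀ i, IsOrthonormalBasis (V i) (e i))
    -- the assumptions `d₁ = d₂`, `[111] = [222]`, `[112] = [122] > 0`
    (hd : d 0 = d 1)
    (h111 : structuralConstant (e 0) (e 0) (e 0) = structuralConstant (e 1) (e 1) (e 1))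
    (h112 : structuralConstant (e 0) (e 0) (e 1) = structuralConstant (e 0) (e 1) (e 1))
    (hpos : 0 < structuralConstant (e 0) (e 0) (e 1))
    (hE : gB.IsEinstein) :
    (gB.IsGlobalMax ↔ ∀ g ∈ gB.sameVolume, g.IsEinstein → g = gB) ∧
    (¬ gB.IsGlobalMax →
      gB.IsLocalMinimum ∧
      ∃ g₁ g₂ : InvariantMetric D, g₁ ≠ g₂ ∧ g₁ ≠ gB ∧ g₂ ≠ gB ∧
        {g | g ∈ gB.sameVolume ∧ g.IsEinstein} = {gB, g₁, g₂} ∧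
        g₁.IsLocalMaximum ∧ g₂.IsLocalMaximum ∧
        (g₁.IsGlobalMax ∨ g₂.IsGlobalMax)) := by
  have hd0 : ∀ i, 0 < d i := fun i => (hV.irreducible i).card_pos (he i)
  obtain ⟨ρ, hρ⟩ := hE
  -- Taking the trace over `V i` will give `d i * c j k i = [ijk]`.
  choose c hc using fun j k => hV.exists_diagonal he hd (bracketForm (e j) (e k))
    (fun X _ Y _ => bracketForm_symm _ _ X Y)
    (fun l hl X _ Y _ => bracketForm_Ad (he j) (he k) (hV.irreducible j).1 (hV.irreducible k).1 hl X Y)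
  set v := hV.basis he with hv
  have hcB : HasCoefficients gB v fun _ => 1 := hgB.hasCoefficients hV he
  have hsc : ∀ i j k, (d i : ℝ) * c j k i = structuralConstant (e i) (e j) (e k) := by
    intro i j k
    rw [← sum_bracketForm]
    have : ∀ a, bracketForm (e j) (e k) (e i a) (e i a) = c j k i := fun a => by
      have := hc j k ⟨i, a⟩ ⟨i, a⟩
      rwa [if_pos rfl] at this
    simp [this]
  set a := structuralConstant (e 0) (e 0) (e 0)
  set b := structuralConstant (e 0) (e 0) (e 1)
  set m : ℝ := (d 0 : ℝ) with hm
  have hm0 : 0 < m := by rw [hm]; exact_mod_cast hd0 0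
  have hm1 : (d 1 : ℝ) = m := by rw [hm, hd]
  have s010 : structuralConstant (e 0) (e 1) (e 0) = b := by
    rw [structuralConstant_swap, structuralConstant_rotate]
  have s100 : structuralConstant (e 1) (e 0) (e 0) = b := structuralConstant_rotate _ _ _
  have s101 : structuralConstant (e 1) (e 0) (e 1) = b := by
    rw [structuralConstant_swap, ← h112]
  have s110 : structuralConstant (e 1) (e 1) (e 0) = b := by
    rw [structuralConstant_rotate, structuralConstant_rotate, ← h112]
  have c000 : m * c 0 0 0 = a := hsc 0 0 0
  have c010 : m * c 0 1 0 = b := hsc 0 0 1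
  have c100 : m * c 1 0 0 = b := (hsc 0 1 0).trans s010
  have c110 : m * c 1 1 0 = b := (hsc 0 1 1).trans h112.symm
  have c001 : m * c 0 0 1 = b := by rw [← hm1]; exact (hsc 1 0 0).trans s100
  have c011 : m * c 0 1 1 = b := by rw [← hm1]; exact (hsc 1 0 1).trans s101
  have c101 : m * c 1 0 1 = b := by rw [← hm1]; exact (hsc 1 1 0).trans s110
  have c111 : m * c 1 1 1 = a := by rw [← hm1]; exact (hsc 1 1 1).trans h111.symm
  choose x hx using fun g : InvariantMetric D => g.exists_hasCoefficients hV he hd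
  have hxpos : ∀ g i, 0 < x g i := fun g i => (hx g).pos hd0 i
  have hvol : ∀ g, g ∈ gB.sameVolume ↔ x g 0 * x g 1 = 1 := fun g =>
    (hx g).volDensity_eq_iff hcB hd hd0
  have hric := fun g : InvariantMetric D => (hx g).ric_basis hgB hV he hd0 hρ hc
  have hvol' : ∀ g ∈ gB.sameVolume, x g 1 = (x g 0)⁻¹ := fun g hg =>
    eq_inv_of_mul_eq_one_right ((hvol g).1 hg)
  -- The `b / 4` is the constant part of the three weight differences multiplying `b`. The constant
  -- `a` drops out, as its weight is `1/4` for every metric.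
  set A : ℝ := m * ρ + b / 4 with hA
  have hr0 : ∀ g ∈ gB.sameVolume, m * ricciCoefficient ρ c (x g) 0 =
      A - b / 2 * (x g 0)⁻¹ ^ 2 + b / 4 * (x g 0) ^ 4 := by
    intro g hg
    have h0 := (hxpos g 0).ne'
    have key : ∀ w₀ w₁ w₂ w₃ : ℝ, m * (ρ + (w₀ * c 0 0 0 + w₁ * c 0 1 0 +
        (w₂ * c 1 0 0 + w₃ * c 1 1 0))) = m * ρ + (w₀ * a + w₁ * b + (w₂ * b + w₃ * b)) := by
      intro w₀ w₁ w₂ w₃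
      linear_combination w₀ * c000 + w₁ * c010 + w₂ * c100 + w₃ * c110
    simp only [ricciCoefficient, Fin.sum_univ_two, key, ricciWeight, hvol' g hg]
    rw [hA]
    field_simp
    ring
  have hr1 : ∀ g ∈ gB.sameVolume, m * ricciCoefficient ρ c (x g) 1 =
      A - b / 2 * (x g 0) ^ 2 + b / 4 * (x g 0)⁻¹ ^ 4 := by
    intro g hg
    have h0 := (hxpos g 0).ne'
    have key : ∀ w₀ w₁ w₂ w₃ : ℝ, m * (ρ + (w₀ * c 0 0 1 + w₁ * c 0 1 1 +
        (w₂ * c 1 0 1 + w₃ * c 1 1 1))) = m * ρ + (w₀ * b + w₁ * b + (w₂ * b + w₃ * a)) := by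
      intro w₀ w₁ w₂ w₃
      linear_combination w₀ * c001 + w₁ * c011 + w₂ * c101 + w₃ * c111
    simp only [ricciCoefficient, Fin.sum_univ_two, key, ricciWeight, hvol' g hg]
    rw [hA]
    field_simp
    ring
  have hsame : ∀ g ∈ gB.sameVolume, g.sameVolume = gB.sameVolume := by
    intro g hg
    ext g'
    change g'.volDensity = g.volDensity ↔ g'.volDensity = gB.volDensity
    rw [show g.volDensity = gB.volDensity from hg]
  have hX : ∀ g, x g 0 = g.form (v ⟨0, ⟨0, hd0 0⟩⟩) (v ⟨0, ⟨0, hd0 0⟩⟩) := fun g => by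
    rw [hx g, if_pos rfl]
  have main := max_iff_unique_critical gB.sameVolume (fun g => x g 0) InvariantMetric.scal
    InvariantMetric.IsEinstein gB A b hpos
    (by simp only [hX]; exact InvariantMetric.continuous_form_apply _ _)
    (fun g => hxpos g 0)
    (by
      intro g hg
      rw [InvariantMetric.scal_eq (hx g) hd0 (hric g), hm1, ← hm, mul_div_assoc', mul_div_assoc',
        hr0 g hg, hr1 g hg, hvol' g hg]
      have h0 := (hxpos g 0).ne'
      field_simp
      ring)
    (by
      intro g hg
      rw [InvariantMetric.isEinstein_iff (hx g) hd0 (hric g), ← mul_right_inj' hm0.ne',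
        mul_div_assoc', mul_div_assoc', hr0 g hg, hr1 g hg, hvol' g hg]
      have h0 := hxpos g 0
      set y := x g 0
      -- The difference of the two Ricci eigenvalues, scaled by `m`, splits off the factor `y - y⁻¹`
      -- belonging to `gB`.
      have key : (A - b / 2 * y⁻¹ ^ 2 + b / 4 * y ^ 4) / y -
          (A - b / 2 * y ^ 2 + b / 4 * y⁻¹ ^ 4) / y⁻¹ =
          (y - y⁻¹) * (3 * b / 4 * ((y + y⁻¹) ^ 2 - 1) - A) := by
        field_simp
        ring
      rw [← sub_eq_zero, key, mul_eq_zero, sub_eq_zero, sub_eq_zero]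
      refine or_congr_left ⟨fun h => ?_, fun h => by rw [h]; norm_num⟩
      field_simp at h
      nlinarith)
    (by
      intro g hg g' hg' h
      refine (hx g).eq ?_
      have : x g = x g' := by
        funext i
        fin_cases i
        · exact h
        · change x g 1 = x g' 1
          rw [hvol' g hg, hvol' g' hg']
          exact congrArg _ h
      rw [this]; exact hx g')
    (by
      intro y hy
      obtain ⟨g, hg⟩ := exists_invariantMetric hV he ![y, y⁻¹] (by
        intro i; fin_cases i
        · exact hy
        · exact inv_pos.2 hy)
      have hxg : x g = ![y, y⁻¹] := (hx g).unique hg hd0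
      refine ⟨g, (hvol g).2 ?_, ?_⟩
      · rw [hxg]; exact mul_inv_cancel₀ hy.ne'
      · simp [hxg])
    rfl
    (by
      have := (hx gB).unique hcB hd0
      simp [this])
  refine ⟨main.1, fun h => ?_⟩
  obtain ⟨h0, g₁, hg₁, g₂, hg₂, h12, h10, h20, hset, hmax₁, hmax₂⟩ := main.2 h
  have hm₁ : IsMaxOn InvariantMetric.scal g₁.sameVolume g₁ := by rwa [hsame g₁ hg₁]
  have hm₂ : IsMaxOn InvariantMetric.scal g₂.sameVolume g₂ := by rwa [hsame g₂ hg₂]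
  exact ⟨h0, g₁, g₂, h12, h10, h20, hset, hm₁.localize, hm₂.localize, Or.inl hm₁⟩
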